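/- **Conventions.** A cover of a space is an indexed family of subsets with union the whole space; a map of covers $\{U_\alpha\}_{\alpha\in A}\to\{V_\beta\}_{\beta\in B}$ is a map $\xi:A\to B$ with $U_\alpha\subseteq V_{\xi(\alpha)}$ for all $\alpha$. A tower of covers of $Z$ with resolution $r\in\mathbb R$ is a family $\mathfrak W=\{\mathcal W_\varepsilon\}_{\varepsilon\ge r}$ of finite covers of $Z$ by path connected open sets, with maps of covers $w_{\varepsilon,\varepsilon'}:\mathcal W_\varepsilon\to\mathcal W_{\varepsilon'}$ for $r\le\varepsilon\le\varepsilon'$ such that $w_{\varepsilon,\varepsilon}=\mathrm{id}$ and $w_{\varepsilon',\varepsilon''}\circ w_{\varepsilon,\varepsilon'}=w_{\varepsilon,\varepsilon''}$. If $r>0$, the reindexed tower $\mathrm R_{\log}\mathfrak W$ has resolution $\log r$, covers $\mathcal W_{\exp\varepsilon}$ for $\varepsilon\ge\log r$, and maps $w_{\exp\varepsilon,\exp\varepsilon'}$. Let $c\ge1$ and $s>0$. A tower of covers $\mathfrak W$ of a compact metric space $(Z,d_Z)$ is $(c,s)$-good if (1) its resolution is $s$, and $s\le\operatorname{diam}(Z)$;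 (2) $\operatorname{diam}(W)\le\varepsilon$ for every member $W$ of $\mathcal W_\varepsilon$ and every $\varepsilon\ge s$; (3) every $O\subseteq Z$ with $\operatorname{diam}(O)\ge s$ is contained in some member of $\mathcal W_{c\cdot\operatorname{diam}(O)}$. A map $f:X\to Z$ is well-behaved if $f^{-1}(U)$ has finitely many path components for every path connected open $U\subseteq Z$. For continuous well-behaved $f$ and a cover $\mathcal U=\{U_\alpha\}$ of $Z$, the pullback $f^*(\mathcal U)$ is the cover of $X$ by the path components of the sets $f^{-1}(U_\alpha)$; a map of covers given by $\xi$ pulls back to the map sending a path component of $f^{-1}(U_\alpha)$ to the path component of $f^{-1}(V_{\xi(\alpha)})$ containing it. The multiscale mapper $\mathrm{MM}(\mathfrak W,f)$ is the tower of simplicial complexes formed by the nerves of the pullbacks $f^*(\mathcal W_\varepsilon)$ with the induced simplicial maps. Fix a field; $\mathrm D_k\mathrm{MM}(\mathfrak W,f)$ denotes the persistence diagram of the persistence module $\varepsilon\mapsto \mathrm H_k\big(N(f^*(\mathcal W_\varepsilon))\big)$ (simplicial homology with coefficients in the field, and zero below the resolution), a multiset of points $(b,d)$ with $b<d\le\infty$.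 The bottleneck distance is the infimum of the $r\in[0,\infty]$ for which there is a partial matching of the points of the two diagrams such that matched points are at $\ell^\infty$-distance at most $r$ and unmatched points are at $\ell^\infty$-distance at most $r$ from the diagonal. **Statement.** Let $\mathfrak W$ be a $(c,s)$-good tower of covers of a compact connected metric space $(Z,d_Z)$, let $X$ be a topological space, and let $f,g:X\to Z$ be well-behaved continuous maps such that $\delta=\sup_{x\in X}d_Z(f(x),g(x))$ (with $X$ non-empty). Then for every field of coefficients and every $k\in\mathbb N$ the bottleneck distance between $\mathrm D_k\mathrm{MM}(\mathrm R_{\log}\mathfrak W,f)$ and $\mathrm D_k\mathrm{MM}(\mathrm R_{\log}\mathfrak W,g)$ is at most $$\log\big(2c\max(s,\delta)+c\big)+\max\Big(0,\log\frac1s\Big).$$ -/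

import Mathlib

open CategoryTheory Topology
open scoped ENNReal

universe u v w t

/-! ### Covers and maps of covers -/

/-- A cover of `X`: an indexed family of subsets whose union is `X`. -/
structure Cover (X : Type u) where
  /-- the index set -/
  ι : Type v
  /-- the members of the cover -/
  set : ι → Set X
  iUnion_eq : ⋃ i, set i = Set.univ

namespace Cover

/-- A map of covers `U → V`: a map `ξ` of the index sets with `U i ⊆ V (ξ i)` for all `i`. -/
@[ext]
structure Hom {X : Type u} (U V : Cover.{u, v} X) where
  toFun : U.ι → V.ι
  subset : ∀ i, U.set i ⊆ V.set (toFun i)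

instance {X : Type u} : Category (Cover.{u, v} X) where
  Hom := Hom
  id U := ⟨id, fun _ => subset_rfl⟩
  comp ξ ζ := ⟨ζ.toFun ∘ ξ.toFun, fun i => (ξ.subset i).trans (ζ.subset _)⟩

/-- A finite cover by path connected open sets. -/
structure IsFinitePathConnectedOpen {X : Type u} [TopologicalSpace X] (U : Cover.{u, v} X) :
    Prop where
  finite : Finite U.ι
  isOpen : ∀ i, IsOpen (U.set i)
  isPathConnected : ∀ i, IsPathConnected (U.set i)

end Cover

/-! ### Towers -/

/-- A tower of objects of a category `C` with resolution `res`: objects indexed by the real numbers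
`ε ≥ res` and, functorially, a morphism for every `ε ≤ ε'`. -/
structure Tower (C : Type u) [Category.{v} C] where
  /-- the resolution -/
  res : ℝ
  /-- the objects and the maps -/
  functor : Set.Ici res ⥤ C

namespace Tower

/-- Apply a functor to every object and every map of a tower. -/
def map {C : Type u} [Category.{v} C] {D : Type w} [Category.{t} D] (W : Tower C) (F : C ⥤ D) :
    Tower D :=
  ⟨W.res, W.functor ⋙ F⟩

/-- The tower `W` of resolution `r > 0`, reindexed by the logarithm: its resolution is `log r` and
its object at `ε` is the object of `W` at `exp ε`. -/
noncomputable def logReindex {C : Type u} [Category.{v} C] (W : Tower C) : Tower C where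
  res := Real.log W.res
  functor :=
    Monotone.functor
      (f := fun ε : Set.Ici (Real.log W.res) =>
        (⟨Real.exp ε, (Real.le_exp_log W.res).trans (Real.exp_le_exp.2 ε.2)⟩ : Set.Ici W.res))
      (fun _ _ h => Real.exp_le_exp.2 h) ⋙ W.functor

end Tower

/-! ### Pullback covers -/

namespace Cover

variable {X : Type u} [TopologicalSpace X]

/-- The set of points of `X` which form the path component `C` of the subspace `A`. -/
def componentSet {A : Set X} (C : ZerothHomotopy A) : Set X :=
  {x | ∃ h : x ∈ A, ZerothHomotopy.mk (⟨x, h⟩ : A) = C}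

/-- For `A ⊆ B`, the path component of `B` that contains a given path component of `A`. -/
def componentMap {A B : Set X} (h : A ⊆ B) : ZerothHomotopy A → ZerothHomotopy B :=
  ZerothHomotopy.lift (fun x => ZerothHomotopy.mk (Set.inclusion h x))
    (fun _ _ p => ZerothHomotopy.sound (p.map (continuous_inclusion h)))

lemma componentSet_subset {A B : Set X} (h : A ⊆ B) (C : ZerothHomotopy A) :
    componentSet C ⊆ componentSet (componentMap h C) := by
  rintro x ⟨hx, rfl⟩
  exact ⟨h hx, rfl⟩

/-- The pullback along `f : X → Z`: a cover `U` of `Z` is sent to the cover of `X` by the path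
components of the sets `f ⁻¹' U i`, and a map of covers `U → V` given by `ξ` to the map sending a
path component of `f ⁻¹' U i` to the path component of `f ⁻¹' V (ξ i)` that contains it. -/
def pullback {Z : Type w} (f : X → Z) : Cover.{w, v} Z ⥤ Cover.{u, max u v} X where
  obj U :=
    { ι := Σ i : U.ι, ZerothHomotopy (f ⁻¹' U.set i)
      set := fun p => componentSet p.2
      iUnion_eq := by
        refine Set.eq_univ_of_forall fun x => ?_
        have hx : f x ∈ ⋃ i, U.set i := by rw [U.iUnion_eq]; trivial
        obtain ⟨i, hi⟩ := Set.mem_iUnion.1 hx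
        exact Set.mem_iUnion.2 ⟨⟨i, ZerothHomotopy.mk ⟨x, hi⟩⟩, hi, rfl⟩ }
  map {U V} ξ :=
    { toFun := fun p => ⟨ξ.toFun p.1, componentMap (Set.preimage_mono (ξ.subset p.1)) p.2⟩
      subset := fun _ => componentSet_subset _ _ }
  map_id U := by
    apply Cover.Hom.ext
    funext ⟨i, C⟩
    induction C with
    | mk x => rfl
  map_comp ξ ζ := by
    apply Cover.Hom.ext
    funext ⟨i, C⟩
    induction C with
    | mk x => rfl

end Cover

/-! ### Simplicial complexes, nerves and simplicial homology -/

/-- An abstract simplicial complex, bundled with its vertex type. (Not every element of the vertex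
type has to be a face.) -/
structure SimplicialComplex where
  /-- the type of vertices -/
  V : Type v
  /-- the faces -/
  complex : PreAbstractSimplicialComplex V

namespace SimplicialComplex

open Classical in
/-- A simplicial map: a map of vertices that sends faces to faces. -/
@[ext]
structure Hom (K L : SimplicialComplex.{v}) where
  toFun : K.V → L.V
  image_mem : ∀ σ ∈ K.complex, σ.image toFun ∈ L.complex

instance : Category SimplicialComplex.{v} where
  Hom := Hom
  id K := ⟨id, fun σ hσ => by simpa using hσ⟩
  comp φ ψ := ⟨ψ.toFun ∘ φ.toFun, fun σ hσ => by
    classical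
    simpa [Finset.image_image] using ψ.image_mem _ (φ.image_mem σ hσ)⟩

open Classical in
/-- The simplicial set of ordered simplices of a simplicial complex: its `n`-simplices are the
tuples `(v₀, …, vₙ)` of vertices, repetitions allowed, such that `{v₀, …, vₙ}` is a face. Its chain
complex is the ordered chain complex of the simplicial complex, which computes the simplicial
homology. -/
def toSSet : SimplicialComplex.{v} ⥤ SSet.{v} where
  obj K :=
    { obj := fun n =>
        {σ : Fin (n.unop.len + 1) → K.V // Finset.univ.image σ ∈ K.complex}
      map := fun {m n} θ => ↾fun σ => ⟨σ.1 ∘ θ.unop.toOrderHom, by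
        refine (K.complex.isRelLowerSet_faces σ.2).2 ?_ (Finset.univ_nonempty.image _)
        intro x hx
        obtain ⟨i, -, rfl⟩ := Finset.mem_image.1 hx
        exact Finset.mem_image_of_mem _ (Finset.mem_univ _)⟩ }
  map {K L} φ :=
    { app := fun n => ↾fun σ => ⟨φ.toFun ∘ σ.1, by
        rw [← Finset.image_image]
        exact φ.image_mem _ σ.2⟩ }

/-- The `n`-th simplicial homology with coefficients in the field `𝕜`. -/
noncomputable def homology (𝕜 : Type w) [Field 𝕜] (n : ℕ) :
    SimplicialComplex.{v} ⥤ ModuleCat.{max v w} 𝕜 :=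
  toSSet ⋙ SSet.homologyFunctor (ModuleCat.of 𝕜 (ULift.{v} 𝕜)) n

end SimplicialComplex

/-- The nerve of a cover: a nonempty finite set of indices is a face iff the intersection of the
corresponding members of the cover is nonempty. -/
def Cover.nerve {X : Type u} : Cover.{u, v} X ⥤ SimplicialComplex.{v} where
  obj U :=
    { V := U.ι
      complex :=
        { faces := {σ | σ.Nonempty ∧ (⋂ i ∈ σ, U.set i).Nonempty}
          isRelLowerSet_faces := fun _ hσ =>
            ⟨hσ.1, fun _ hτσ hτ => ⟨hτ, hσ.2.mono (Set.biInter_mono hτσ fun _ _ => subset_rfl)⟩⟩ } }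
  map {U V} ξ :=
    { toFun := ξ.toFun
      image_mem := by
        classical
        rintro σ ⟨hσ, x, hx⟩
        refine ⟨hσ.image _, x, ?_⟩
        simp only [Set.mem_iInter, Finset.mem_image] at hx ⊢
        rintro _ ⟨i, hi, rfl⟩
        exact ξ.subset i (hx i hi) }

/-- The multiscale mapper: the tower of the nerves of the pullbacks of the covers of `W`. -/
def multiscaleMapper {X : Type u} [TopologicalSpace X] {Z : Type w} (W : Tower (Cover.{w, v} Z))
    (f : X → Z) : Tower SimplicialComplex.{max u v} :=
  W.map (Cover.pullback f ⋙ Cover.nerve)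

/-! ### Persistence diagrams -/

/-- A persistence diagram, as a multiset of points `(b, d)` with birth `b` and death `d`, possibly
infinite: the function giving the multiplicity of each point. -/
abbrev PersistenceDiagram := ℝ × WithTop ℝ → ℕ

namespace Tower

variable {𝕜 : Type w} [Field 𝕜]

/-- The rank of the map `V_a → V_b` of a persistence module, for `a ≤ b`. The module is understood to
be zero at the indices below the resolution. -/
noncomputable def rank (V : Tower (ModuleCat.{v} 𝕜)) (a b : ℝ) : ℕ :=
  open Classical in
  if h : V.res ≤ a ∧ a ≤ b then
    Module.finrank 𝕜 (LinearMap.range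
      (V.functor.map (homOfLE (show (⟨a, h.1⟩ : Set.Ici V.res) ≤ ⟨b, h.1.trans h.2⟩ from h.2))).hom)
  else 0

/-- The persistence diagram of a (pointwise finite dimensional) persistence module. The expression
`rank (b + ε) (d - ε) - rank (b - ε) (d - ε) - rank (b + ε) (d + ε) + rank (b - ε) (d + ε)` counts
the classes born between `b - ε` and `b + ε` that die between `d - ε` and `d + ε`. It does not
increase as `ε` decreases, and the multiplicity of `(b, d)` is its limit, i.e. its least value.
Likewise, `rank (b + ε) c - rank (b - ε) c` counts the classes born between `b - ε` and `b + ε` that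
are alive at `c`; the multiplicity of `(b, ∞)` is the least value for small `ε` and large `c`. -/
noncomputable def persistenceDiagram (V : Tower (ModuleCat.{v} 𝕜)) : PersistenceDiagram
  | (b, some d) => sInf {m : ℕ | ∃ ε > 0, b + ε < d - ε ∧
      (m : ℤ) = (V.rank (b + ε) (d - ε) : ℤ) - V.rank (b - ε) (d - ε)
        - V.rank (b + ε) (d + ε) + V.rank (b - ε) (d + ε)}
  | (b, none) => sInf {m : ℕ | ∃ ε > 0, ∃ c > b + ε,
      (m : ℤ) = (V.rank (b + ε) c : ℤ) - V.rank (b - ε) c}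

/-- The persistence diagram in dimension `k` of a tower of simplicial complexes, with coefficients
in the field `𝕜`. -/
noncomputable def diagram (𝕜 : Type w) [Field 𝕜] (k : ℕ) (S : Tower SimplicialComplex.{v}) :
    PersistenceDiagram :=
  (S.map (SimplicialComplex.homology 𝕜 k)).persistenceDiagram

end Tower

namespace PersistenceDiagram

/-- The points of a diagram, each repeated as often as its multiplicity says. -/
def Points (D : PersistenceDiagram) : Type := Σ p : ℝ × WithTop ℝ, Fin (D p)

/-- The `ℓ^∞` distance between two points of the extended plane. -/
noncomputable def pointDist : ℝ × WithTop ℝ → ℝ × WithTop ℝ → ℝ≥0∞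
  | (b, some d), (b', some d') => max (edist b b') (edist d d')
  | (b, none), (b', none) => edist b b'
  | (_, some _), (_, none) => ⊤
  | (_, none), (_, some _) => ⊤

/-- The `ℓ^∞` distance of a point of the extended plane from the diagonal. -/
noncomputable def diagonalDist : ℝ × WithTop ℝ → ℝ≥0∞
  | (b, some d) => edist b d / 2
  | (_, none) => ⊤

/-- `M` is a partial matching between the points of `D` and the points of `E` in which matched
points are at distance at most `r` and unmatched points are at distance at most `r` from the
diagonal. -/
structure IsMatching (D E : PersistenceDiagram) (r : ℝ≥0∞) (M : D.Points → E.Points → Prop) :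
    Prop where
  left_unique : ∀ p p' q, M p q → M p' q → p = p'
  right_unique : ∀ p q q', M p q → M p q' → q = q'
  matched : ∀ p q, M p q → pointDist p.1 q.1 ≤ r
  unmatched_left : ∀ p, (∀ q, ¬ M p q) → diagonalDist p.1 ≤ r
  unmatched_right : ∀ q, (∀ p, ¬ M p q) → diagonalDist q.1 ≤ r

/-- The bottleneck distance between two persistence diagrams. -/
noncomputable def bottleneckDist (D E : PersistenceDiagram) : ℝ≥0∞ :=
  sInf {r | ∃ M, IsMatching D E r M}

end PersistenceDiagram

/-! ### Well-behaved maps and good towers of covers -/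

/-- `f` is well-behaved: the preimage of every path connected open set has finitely many path
components. -/
def IsWellBehaved {X : Type u} [TopologicalSpace X] {Z : Type v} [TopologicalSpace Z]
    (f : X → Z) : Prop :=
  ∀ U : Set Z, IsOpen U → IsPathConnected U → Finite (ZerothHomotopy (f ⁻¹' U))

/-- A `(c, s)`-good tower of covers of the compact metric space `Z`. -/
structure IsGoodTower {Z : Type u} [MetricSpace Z] (c s : ℝ) (W : Tower (Cover.{u, v} Z)) :
    Prop where
  one_le : 1 ≤ c
  pos : 0 < s
  isFinitePathConnectedOpen : ∀ ε, (W.functor.obj ε).IsFinitePathConnectedOpen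
  res_eq : W.res = s
  le_diam : s ≤ Metric.diam (Set.univ : Set Z)
  diam_le : ∀ ε i, Metric.diam ((W.functor.obj ε).set i) ≤ ε
  exists_superset : ∀ O : Set Z, s ≤ Metric.diam O →
    ∃ h : W.res ≤ c * Metric.diam O, ∃ i, O ⊆ (W.functor.obj ⟨c * Metric.diam O, h⟩).set i

/-! Put m = max(s, δ). If U is a member of the cover at scale a and O is the set of points within m
of U, then f⁻¹(U) ⊆ g⁻¹(O). Connectedness of Z gives diam O ≥ s, and diam O ≤ a + 2m, so goodness
and the tower maps put O in a member of any cover at scale at least c(a + 2m). Choosing such members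
gives maps of pullback covers in both directions between f and g (`nonempty_pullback_hom`). Since a
≥ s, on the logarithmic scale they become an additive shift by the claimed bound η. The choices need
not commute with the tower maps: parallel maps of covers are contiguous on nerves and agree in
homology (`nerve_homology_map_eq`). Hence the two persistence modules V and W are η-interleaved.

Stability follows from ranks alone, by an induced matching. Let Q be the image of V in W shifted by
η; its ranks are those of V_a → W_{b+η}. The map V → Q is onto with kernel killed by a shift of 2η,
so points of equal birth, listed by decreasing death, can be paired by position at the cost of at
most 2η in the death. Dually, Q → W shifted by η is injective with cokernel killed by 2η, so points
of equal death, listed by increasing birth, can be paired by position. The composite is the matching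
of `exists_isMatching`. No interval decomposition is needed: the counts of births and deaths are
differences of ranks, and they are compared by monotonicity of rank and the Frobenius inequality
`finrank_range_comp_add_le`. -/

/-! ### Rank functions and their persistence diagrams -/

/-- A monotone natural-valued function near `0` on the right takes its least value. -/
lemma eventually_eq_sInf_image {g : ℝ → ℕ} {S : Set ℝ} (hS : S ∈ 𝓝[>] (0 : ℝ))
    (hpos : S ⊆ Set.Ioi 0) (hg : MonotoneOn g S) :
    ∀ᶠ ε in 𝓝[>] (0 : ℝ), g ε = sInf (g '' S) := by
  obtain ⟨x, hx⟩ : S.Nonempty := Filter.nonempty_of_mem hS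
  -- The least value is attained at some ε₀ by well-ordering; monotonicity propagates it to all
  -- smaller ε.
  obtain ⟨ε₀, h₀, h₀'⟩ := Nat.sInf_mem (⟨_, Set.mem_image_of_mem g hx⟩ : (g '' S).Nonempty)
  filter_upwards [hS, Ioo_mem_nhdsGT (hpos h₀)] with ε hε hε'
  exact le_antisymm (h₀' ▸ hg hε h₀ hε'.2.le) (Nat.sInf_le (Set.mem_image_of_mem g hε))

/-- The properties of the function `(a, b) ↦ rank (V_a → V_b)`, for `a ≤ b`, of a pointwise finite
dimensional persistence module `V` that vanishes far enough to the left. -/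
structure IsRankFunction (r : ℝ → ℝ → ℕ) : Prop where
  mono : ∀ {a' a b}, a' ≤ a → a ≤ b → r a' b ≤ r a b
  anti : ∀ {a b b'}, a ≤ b → b ≤ b' → r a b' ≤ r a b
  rect : ∀ {a' a b b'}, a' ≤ a → a ≤ b → b ≤ b' → r a' b + r a b' ≤ r a b + r a' b'
  eventually_zero : ∃ s, ∀ a < s, ∀ b, r a b = 0

/-- The persistence diagram determined by a rank function. -/
noncomputable def rankDiagram (r : ℝ → ℝ → ℕ) : PersistenceDiagram
  | (b, some d) => sInf {m : ℕ | ∃ ε > 0, b + ε < d - ε ∧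
      (m : ℤ) = (r (b + ε) (d - ε) : ℤ) - r (b - ε) (d - ε) - r (b + ε) (d + ε) + r (b - ε) (d + ε)}
  | (b, none) => sInf {m : ℕ | ∃ ε > 0, ∃ c > b + ε, (m : ℤ) = (r (b + ε) c : ℤ) - r (b - ε) c}

/-- The number of classes born at `b` that are alive at `c`. -/
noncomputable def bornAt (r : ℝ → ℝ → ℕ) (b c : ℝ) : ℕ :=
  sInf ((fun ε => r (b + ε) c - r (b - ε) c) '' Set.Ioc 0 (c - b))

/-- The number of classes dying at `d` that are born up to `a`. -/
noncomputable def dyingAt (r : ℝ → ℝ → ℕ) : WithTop ℝ → ℝ → ℕ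
  | some d, a => sInf ((fun ε => r a (d - ε) - r a (d + ε)) '' Set.Ioc 0 (d - a))
  | none, a => sInf (r a '' Set.Ici a)

namespace IsRankFunction

variable {r : ℝ → ℝ → ℕ} (h : IsRankFunction r)
include h

lemma eventually_bornAt {b c : ℝ} (hbc : b < c) :
    ∀ᶠ ε in 𝓝[>] (0 : ℝ), r (b + ε) c = r (b - ε) c + bornAt r b c := by
  have hS : Set.Ioc 0 (c - b) ∈ 𝓝[>] (0 : ℝ) := Ioc_mem_nhdsGT (sub_pos.2 hbc)
  filter_upwards [hS, eventually_eq_sInf_image (g := fun ε => r (b + ε) c - r (b - ε) c) hS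
    (fun _ hx => hx.1) (fun x hx y hy hxy => by
      have := h.mono (show b + x ≤ b + y by linarith) (show b + y ≤ c by linarith [hy.2])
      have := h.mono (show b - y ≤ b - x by linarith) (show b - x ≤ c by linarith [hx.1])
      dsimp only; lia)] with ε hε hε'
  have := h.mono (show b - ε ≤ b + ε by linarith [hε.1]) (show b + ε ≤ c by linarith [hε.2])
  rw [bornAt, ← hε']
  lia

lemma bornAt_anti {b c c' : ℝ} (hbc : b < c) (hcc' : c ≤ c') : bornAt r b c' ≤ bornAt r b c := by
  obtain ⟨ε, h₁, h₂, h₃, h₄⟩ := ((h.eventually_bornAt hbc).and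
    ((h.eventually_bornAt (hbc.trans_le hcc')).and (Ioc_mem_nhdsGT (sub_pos.2 hbc)))).exists
  have := h.rect (show b - ε ≤ b + ε by linarith) (show b + ε ≤ c by linarith) hcc'
  lia

lemma eventually_dyingAt {a d : ℝ} (had : a < d) :
    ∀ᶠ ε in 𝓝[>] (0 : ℝ), r a (d - ε) = r a (d + ε) + dyingAt r d a := by
  have hS : Set.Ioc 0 (d - a) ∈ 𝓝[>] (0 : ℝ) := Ioc_mem_nhdsGT (sub_pos.2 had)
  filter_upwards [hS, eventually_eq_sInf_image (g := fun ε => r a (d - ε) - r a (d + ε)) hS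
    (fun _ hx => hx.1) (fun x hx y hy hxy => by
      have := h.anti (show a ≤ d - y by linarith [hy.2]) (show d - y ≤ d - x by linarith)
      have := h.anti (show a ≤ d + x by linarith [hx.1]) (show d + x ≤ d + y by linarith)
      dsimp only; lia)] with ε hε hε'
  have := h.anti (show a ≤ d - ε by linarith [hε.2]) (show d - ε ≤ d + ε by linarith [hε.1])
  change _ = _ + sInf ((fun ε => r a (d - ε) - r a (d + ε)) '' Set.Ioc 0 (d - a))
  rw [← hε']
  lia

lemma eventually_dyingAt_top (a : ℝ) : ∀ᶠ c in Filter.atTop, r a c = dyingAt r ⊤ a := by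
  change ∀ᶠ c in Filter.atTop, r a c = sInf (r a '' Set.Ici a)
  obtain ⟨c₀, h₀, h₀'⟩ := Nat.sInf_mem (⟨_, Set.mem_image_of_mem (r a) (Set.self_mem_Ici (a := a))⟩ :
    (r a '' Set.Ici a).Nonempty)
  filter_upwards [Filter.eventually_ge_atTop c₀] with c hc
  exact le_antisymm (h₀' ▸ h.anti h₀ hc)
    (Nat.sInf_le (Set.mem_image_of_mem _ ((Set.mem_Ici.1 h₀).trans hc)))

lemma dyingAt_mono {d : WithTop ℝ} {a' a : ℝ} (haa' : a' ≤ a) (had : (a : WithTop ℝ) < d) :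
    dyingAt r d a' ≤ dyingAt r d a := by
  induction d with
  | top =>
    obtain ⟨c, h₁, h₂, h₃⟩ := ((h.eventually_dyingAt_top a).and
      ((h.eventually_dyingAt_top a').and (Filter.eventually_ge_atTop a))).exists
    rw [← h₁, ← h₂]
    exact h.mono haa' h₃
  | coe d =>
    have had := WithTop.coe_lt_coe.1 had
    obtain ⟨ε, h₁, h₂, h₃, h₄⟩ := ((h.eventually_dyingAt had).and
      ((h.eventually_dyingAt (haa'.trans_lt had)).and (Ioc_mem_nhdsGT (sub_pos.2 had)))).exists
    have := h.rect haa' (show a ≤ d - ε by linarith) (show d - ε ≤ d + ε by linarith)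
    lia

/-- The alternating sum counts points in a box around (b, d). A larger box splits into smaller ones
of nonnegative count by `rect`, so the count decreases with ε and stabilises at its infimum. -/
lemma eventually_rankDiagram {b d : ℝ} (hbd : b < d) :
    ∀ᶠ ε in 𝓝[>] (0 : ℝ), r (b + ε) (d - ε) + r (b - ε) (d + ε) =
      r (b - ε) (d - ε) + r (b + ε) (d + ε) + rankDiagram r (b, d) := by
  set S := Set.Ioo 0 ((d - b) / 2)
  have hS : S ∈ 𝓝[>] (0 : ℝ) := Ioo_mem_nhdsGT (by linarith)
  -- The truncated subtraction is exact on S, by `rect`.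
  set g : ℝ → ℕ := fun ε =>
    (r (b + ε) (d - ε) + r (b - ε) (d + ε)) - (r (b - ε) (d - ε) + r (b + ε) (d + ε))
  have hg : ∀ ε ∈ S, r (b - ε) (d - ε) + r (b + ε) (d + ε) + g ε =
      r (b + ε) (d - ε) + r (b - ε) (d + ε) := fun ε hε => by
    have := h.rect (show b - ε ≤ b + ε by linarith [hε.1])
      (show b + ε ≤ d - ε by linarith [hε.2]) (show d - ε ≤ d + ε by linarith [hε.1])
    dsimp only [g]; lia
  have key : rankDiagram r (b, d) = sInf (g '' S) := by
    change sInf {m : ℕ | _} = _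
    congr 1
    ext m
    constructor
    · rintro ⟨ε, h₀, h₁, h₂⟩
      have hε : ε ∈ S := ⟨h₀, by linarith⟩
      have := hg ε hε
      exact ⟨ε, hε, by lia⟩
    · rintro ⟨ε, hε, rfl⟩
      have := hg ε hε
      exact ⟨ε, hε.1, by linarith [hε.2], by lia⟩
  filter_upwards [hS, eventually_eq_sInf_image (g := g) hS (fun _ hx => hx.1)
    (fun x hx y hy hxy => by
      have hx0 := hx.1
      have hy2 := hy.2
      have hgx := hg x hx
      have hgy := hg y hy
      have := h.rect (show b - y ≤ b - x by linarith) (show b - x ≤ d - y by linarith)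
        (show d - y ≤ d + y by linarith)
      have := h.rect (show b + x ≤ b + y by linarith) (show b + y ≤ d - y by linarith)
        (show d - y ≤ d + y by linarith)
      have := h.rect (show b - x ≤ b + x by linarith) (show b + x ≤ d - y by linarith)
        (show d - y ≤ d - x by linarith)
      have := h.rect (show b - x ≤ b + x by linarith) (show b + x ≤ d + x by linarith)
        (show d + x ≤ d + y by linarith)
      lia)] with ε hε hε'
  rw [key, ← hε', hg ε hε]

/-- A pair (ε₀, c₀) attaining the least count still attains it after shrinking ε and enlarging c,
because both changes can only lower the count. -/
lemma exists_rankDiagram_top (b : ℝ) : ∃ c₀ > b, ∀ c ≥ c₀,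
    ∀ᶠ ε in 𝓝[>] (0 : ℝ), r (b + ε) c = r (b - ε) c + rankDiagram r (b, ⊤) := by
  set T := {m : ℕ | ∃ ε > 0, ∃ c > b + ε, (m : ℤ) = (r (b + ε) c : ℤ) - r (b - ε) c}
  have hT : ∀ ε > 0, ∀ c > b + ε, r (b + ε) c - r (b - ε) c ∈ T := fun ε hε c hc => by
    have := h.mono (show b - ε ≤ b + ε by linarith) (show b + ε ≤ c from hc.le)
    exact ⟨ε, hε, c, hc, by lia⟩
  obtain ⟨ε₀, h₀, c₀, hc₀, hm⟩ : sInf T ∈ T :=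
    Nat.sInf_mem ⟨_, hT 1 one_pos (b + 2) (by linarith)⟩
  refine ⟨c₀, by linarith, fun c hc => ?_⟩
  filter_upwards [Ioo_mem_nhdsGT h₀] with ε ⟨hε, hε'⟩
  change _ = _ + sInf T
  have := Nat.sInf_le (hT ε hε c (by linarith))
  have := h.mono (show b - ε ≤ b + ε by linarith) (show b + ε ≤ c by linarith)
  have := h.rect (show b - ε₀ ≤ b + ε₀ by linarith) hc₀.le hc
  have := h.mono (show b - ε₀ ≤ b - ε by linarith) (show b - ε ≤ c by linarith)
  have := h.mono (show b + ε ≤ b + ε₀ by linarith) (show b + ε₀ ≤ c by linarith)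
  lia

/-- For x < ε, the box of half-widths x in birth and ε in death lies between the squares of
half-widths x and ε. Both squares count the multiplicity, so the box does too. Values at d itself
are avoided, since they depend on whether intervals contain their endpoints. -/
lemma eventually_bornAt_jump {b d : ℝ} (hbd : b < d) :
    ∀ᶠ ε in 𝓝[>] (0 : ℝ), bornAt r b (d - ε) = bornAt r b (d + ε) + rankDiagram r (b, d) := by
  obtain ⟨ε₀, h₀, hE⟩ := (mem_nhdsGT_iff_exists_Ioc_subset.1 (h.eventually_rankDiagram hbd))
  filter_upwards [Ioo_mem_nhdsGT h₀, Ioo_mem_nhdsGT (show 0 < (d - b) / 2 by linarith)]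
    with ε ⟨hε, hε₀⟩ ⟨_, hε₁⟩
  obtain ⟨x, ⟨⟨h₁, h₂⟩, hx, hxε⟩⟩ := (((h.eventually_bornAt (show b < d - ε by linarith)).and
    (h.eventually_bornAt (show b < d + ε by linarith))).and (Ioo_mem_nhdsGT hε)).exists
  have e₁ : _ = _ := hE ⟨hε, hε₀.le⟩
  have e₂ : _ = _ := hE ⟨hx, (hxε.trans hε₀).le⟩
  have := h.rect (show b - ε ≤ b - x by linarith) (show b - x ≤ d - ε by linarith)
    (show d - ε ≤ d + ε by linarith)
  have := h.rect (show b + x ≤ b + ε by linarith) (show b + ε ≤ d - ε by linarith)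
    (show d - ε ≤ d + ε by linarith)
  have := h.rect (show b - x ≤ b + x by linarith) (show b + x ≤ d - ε by linarith)
    (show d - ε ≤ d - x by linarith)
  have := h.rect (show b - x ≤ b + x by linarith) (show b + x ≤ d + x by linarith)
    (show d + x ≤ d + ε by linarith)
  lia

lemma exists_bornAt_eq_rankDiagram_top (b : ℝ) :
    ∃ c₀, ∀ c ≥ c₀, bornAt r b c = rankDiagram r (b, ⊤) := by
  obtain ⟨c₀, hc₀, H⟩ := h.exists_rankDiagram_top b
  refine ⟨c₀, fun c hc => ?_⟩
  obtain ⟨ε, h₁, h₂⟩ := ((h.eventually_bornAt (hc₀.trans_le hc)).and (H c hc)).exists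
  lia

/-- The same squeeze with births and deaths exchanged; for infinite death, a large c replaces the
box in the death direction. -/
lemma eventually_dyingAt_jump {b : ℝ} {d : WithTop ℝ} (hbd : (b : WithTop ℝ) < d) :
    ∀ᶠ ε in 𝓝[>] (0 : ℝ), dyingAt r d (b + ε) = dyingAt r d (b - ε) + rankDiagram r (b, d) := by
  induction d with
  | top =>
    obtain ⟨c₀, hc₀, H⟩ := h.exists_rankDiagram_top b
    obtain ⟨ε₀, h₀, hE⟩ := mem_nhdsGT_iff_exists_Ioc_subset.1 (H _ le_rfl)
    filter_upwards [Ioo_mem_nhdsGT h₀, Ioo_mem_nhdsGT (sub_pos.2 hc₀)] with ε ⟨hε, hε₀⟩ ⟨_, hεc⟩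
    obtain ⟨c, h₁, h₂, h₃⟩ := ((h.eventually_dyingAt_top (b + ε)).and
      ((h.eventually_dyingAt_top (b - ε)).and (Filter.eventually_ge_atTop (max c₀ (b + ε))))).exists
    obtain ⟨h₃, h₄⟩ := max_le_iff.1 h₃
    obtain ⟨x, h₅, hx, hxε⟩ := ((H c h₃).and (Ioo_mem_nhdsGT hε)).exists
    have e : _ = _ := hE ⟨hε, hε₀.le⟩
    have := h.mono (show b - ε ≤ b - x by linarith) (show b - x ≤ c by linarith)
    have := h.mono (show b + x ≤ b + ε by linarith) (show b + ε ≤ c by linarith)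
    have := h.rect (show b - ε ≤ b + ε by linarith) (show b + ε ≤ c₀ by linarith) h₃
    lia
  | coe d =>
    have hbd := WithTop.coe_lt_coe.1 hbd
    obtain ⟨ε₀, h₀, hE⟩ := mem_nhdsGT_iff_exists_Ioc_subset.1 (h.eventually_rankDiagram hbd)
    filter_upwards [Ioo_mem_nhdsGT h₀, Ioo_mem_nhdsGT (show 0 < (d - b) / 2 by linarith)]
      with ε ⟨hε, hε₀⟩ ⟨_, hε₁⟩
    obtain ⟨x, ⟨⟨h₁, h₂⟩, hx, hxε⟩⟩ := (((h.eventually_dyingAt (show b - ε < d by linarith)).and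
      (h.eventually_dyingAt (show b + ε < d by linarith))).and (Ioo_mem_nhdsGT hε)).exists
    have e₁ : _ = _ := hE ⟨hε, hε₀.le⟩
    have e₂ : _ = _ := hE ⟨hx, (hxε.trans hε₀).le⟩
    have := h.rect (show b - ε ≤ b - x by linarith) (show b - x ≤ d - x by linarith)
      (show d - x ≤ d + x by linarith)
    have := h.rect (show b + x ≤ b + ε by linarith) (show b + ε ≤ d - x by linarith)
      (show d - x ≤ d + x by linarith)
    have := h.rect (show b - ε ≤ b + ε by linarith) (show b + ε ≤ d - ε by linarith)
      (show d - ε ≤ d - x by linarith)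
    have := h.rect (show b - ε ≤ b + ε by linarith) (show b + ε ≤ d + x by linarith)
      (show d + x ≤ d + ε by linarith)
    lia

end IsRankFunction

/-! ### Enumerating the points of a diagram by the jumps of a counting function -/

/-- An antitone natural-valued function on an upper set of reals whose jump at `d` is `μ d` and whose
limit at infinity is `μ ⊤` gives an enumeration of the points, where `d` is counted `μ d` times. -/
theorem exists_enumeration {S : Set ℝ} (hS : IsUpperSet S) {f : ℝ → ℕ} (hf : AntitoneOn f S)
    {μ : WithTop ℝ → ℕ} (hμ : ∀ d : ℝ, d ∉ S → μ d = 0)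
    (hjump : ∀ d ∈ S, ∀ᶠ ε in 𝓝[>] (0 : ℝ), d - ε ∈ S ∧ f (d - ε) = f (d + ε) + μ d)
    (htop : ∃ c₀, ∀ c ≥ c₀, c ∈ S → f c = μ ⊤) :
    ∃ k : (Σ d, Fin (μ d)) → ℕ, Function.Injective k ∧
      (∀ p, ∀ c ∈ S, (c : WithTop ℝ) < p.1 → k p < f c) ∧
      (∀ p, ∀ c : ℝ, p.1 < (c : WithTop ℝ) → f c ≤ k p) ∧
      ∀ c ∈ S, ∀ n < f c, ∃ p, k p = n := by
  -- F d is the value of f just to the right of d, and 0 at infinity. The points over d will receive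
  -- the numbers in [F d, F d + μ d), the values skipped by the jump at d.
  have hF : ∀ d : WithTop ℝ, ∃ F : ℕ, (∀ x : ℝ, d = x → x ∈ S) →
      (∀ c ∈ S, (c : WithTop ℝ) < d → F + μ d ≤ f c) ∧ (∀ c : ℝ, d < c → f c ≤ F) ∧
      ∀ n, (∀ c ∈ S, (c : WithTop ℝ) < d → n < f c) → (∀ c : ℝ, d < c → f c ≤ n) →
        S.Nonempty → F ≤ n ∧ n < F + μ d := by
    intro d
    induction d with
    | top =>
      obtain ⟨c₀, hc₀⟩ := htop
      refine ⟨0, fun _ => ⟨fun c hc _ => ?_, by simp, fun n hn _ ⟨c, hc⟩ => ⟨n.zero_le, ?_⟩⟩⟩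
      · rw [zero_add, ← hc₀ _ (le_max_right c c₀) (hS (le_max_left _ _) hc)]
        exact hf hc (hS (le_max_left _ _) hc) (le_max_left _ _)
      · rw [zero_add, ← hc₀ _ (le_max_right c c₀) (hS (le_max_left _ _) hc)]
        exact hn _ (hS (le_max_left _ _) hc) (WithTop.coe_lt_top _)
    | coe d =>
      by_cases hd : d ∈ S
      · obtain ⟨ε₀, h₀, hE⟩ := mem_nhdsGT_iff_exists_Ioc_subset.1 (hjump d hd)
        have h₀ : 0 < ε₀ := h₀
        have hconst : ∀ ε, 0 < ε → ε ≤ ε₀ →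
            f (d - ε) = f (d - ε₀) ∧ f (d + ε) = f (d + ε₀) ∧ d - ε ∈ S := fun ε hε hε' => by
          have e₁ : _ ∧ _ = _ := hE ⟨hε, hε'⟩
          have e₂ : _ ∧ _ = _ := hE ⟨h₀, le_rfl⟩
          have := hf e₂.1 e₁.1 (by linarith)
          have := hf (hS (show d ≤ d + ε by linarith) hd)
            (hS (show d ≤ d + ε₀ by linarith) hd) (show d + ε ≤ d + ε₀ by linarith)
          exact ⟨by lia, by lia, e₁.1⟩
        have e₀ := hE ⟨h₀, le_rfl⟩
        refine ⟨f (d + ε₀), fun _ => ⟨fun c hc hcd => ?_, fun c hcd => ?_, fun n hn hn' _ => ⟨?_, ?_⟩⟩⟩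
        · have hcd := WithTop.coe_lt_coe.1 hcd
          have := hconst (min ε₀ (d - c)) (lt_min h₀ (by linarith)) (min_le_left _ _)
          have h₂ := hf hc this.2.2 (by linarith [min_le_right ε₀ (d - c)])
          rw [this.1, e₀.2] at h₂
          exact h₂
        · have hcd := WithTop.coe_lt_coe.1 hcd
          have := hconst (min ε₀ (c - d)) (lt_min h₀ (by linarith)) (min_le_left _ _)
          rw [← this.2.1]
          exact hf (hS (by linarith [lt_min h₀ (sub_pos.2 hcd)]) hd) (hS hcd.le hd)
            (by linarith [min_le_right ε₀ (c - d)])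
        · exact hn' _ (WithTop.coe_lt_coe.2 (by linarith))
        · exact e₀.2 ▸ hn _ e₀.1 (WithTop.coe_lt_coe.2 (by linarith))
      · exact ⟨0, fun h => absurd (h d rfl) hd⟩
  choose F hF using hF
  have hmem : ∀ p : Σ d, Fin (μ d), ∀ x : ℝ, p.1 = x → x ∈ S := by
    rintro ⟨d, i⟩ x rfl
    by_contra hx
    exact (hμ x hx ▸ i).elim0
  have hk₁ : ∀ p : Σ d, Fin (μ d), ∀ c ∈ S, (c : WithTop ℝ) < p.1 → F p.1 + p.2 < f c :=
    fun p c hc hcd => (Nat.add_lt_add_left p.2.2 _).trans_le ((hF p.1 (hmem p)).1 c hc hcd)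
  have hk₂ : ∀ p : Σ d, Fin (μ d), ∀ c : ℝ, p.1 < c → f c ≤ F p.1 + p.2 :=
    fun p c hcd => ((hF p.1 (hmem p)).2.1 c hcd).trans (Nat.le_add_right _ _)
  -- Blocks over distinct d are disjoint: a real c strictly between them has f c above one block and
  -- at most the other.
  have hlt : ∀ p q : Σ d, Fin (μ d), F p.1 + p.2 = F q.1 + q.2 → ¬ p.1 < q.1 := by
    intro p q hpq hlt
    obtain ⟨c, hc₁, hc₂⟩ := exists_between hlt
    lift c to ℝ using hc₂.ne_top
    obtain ⟨x, hx⟩ := WithTop.ne_top_iff_exists.1 hlt.ne_top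
    have hcS : c ∈ S := hS (WithTop.coe_lt_coe.1 (hx ▸ hc₁)).le (hmem p x hx.symm)
    have := hk₁ q c hcS hc₂
    have := hk₂ p c hc₁
    lia
  refine ⟨fun p => F p.1 + p.2, fun p q hpq => ?_, hk₁, hk₂, fun c hc n hn => ?_⟩
  · have heq : p.1 = q.1 := le_antisymm (not_lt.1 (hlt q p hpq.symm)) (not_lt.1 (hlt p q hpq))
    obtain ⟨d, i⟩ := p
    obtain ⟨d', j⟩ := q
    obtain rfl : d = d' := heq
    obtain rfl : i = j := Fin.ext (by simpa using hpq)
    rfl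
  · suffices H : ∃ d : WithTop ℝ, (∀ x : ℝ, d = x → x ∈ S) ∧
        (∀ c ∈ S, (c : WithTop ℝ) < d → n < f c) ∧ ∀ c : ℝ, d < c → f c ≤ n by
      obtain ⟨d, h₁, h₂, h₃⟩ := H
      obtain ⟨h₄, h₅⟩ := (hF d h₁).2.2 n h₂ h₃ ⟨c, hc⟩
      exact ⟨⟨d, ⟨n - F d, by lia⟩⟩, by simp; lia⟩
    -- The block containing n lies over the place where f falls to n or below: the supremum of D, or
    -- infinity if D is unbounded.
    set D := {x ∈ S | n < f x}
    have hcD : c ∈ D := ⟨hc, hn⟩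
    by_cases hD : BddAbove D
    · have hcs := le_csSup hD hcD
      refine ⟨(sSup D : ℝ), fun x hx => WithTop.coe_injective hx ▸ hS hcs hc, fun y hy hyd => ?_,
        fun y hyd => ?_⟩
      · obtain ⟨x, hx, hyx⟩ := exists_lt_of_lt_csSup ⟨c, hcD⟩ (WithTop.coe_lt_coe.1 hyd)
        exact hx.2.trans_le (hf hy hx.1 hyx.le)
      · have hyd := WithTop.coe_lt_coe.1 hyd
        by_contra! hny
        exact hyd.not_ge (le_csSup hD ⟨hS (hcs.trans hyd.le) hc, hny⟩)
    · refine ⟨⊤, by simp, fun y hy _ => ?_, by simp⟩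
      obtain ⟨x, hx, hyx⟩ := not_bddAbove_iff.1 hD y
      exact hx.2.trans_le (hf hy hx.1 hyx.le)

namespace IsRankFunction

lemma rankDiagram_eq_zero {r : ℝ → ℝ → ℕ} {b : ℝ} {d : WithTop ℝ} (hbd : d ≤ b) : rankDiagram r (b, d) = 0 := by
  lift d to ℝ using ne_top_of_le_ne_top WithTop.coe_ne_top hbd
  have hbd := WithTop.coe_le_coe.1 hbd
  change sInf {m : ℕ | _} = 0
  -- No ε > 0 is admissible on or below the diagonal, and the infimum of the empty set of naturals
  -- is 0.
  convert Nat.sInf_empty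
  ext m
  simp only [Set.mem_ofPred_eq, Set.mem_empty_iff_false, iff_false]
  rintro ⟨ε, hε, h', -⟩
  linarith

lemma birth_lt_death {r : ℝ → ℝ → ℕ} (p : (rankDiagram r).Points) : (p.1.1 : WithTop ℝ) < p.1.2 := by
  obtain ⟨⟨b, d⟩, i⟩ := p
  by_contra hbd
  exact (rankDiagram_eq_zero (not_lt.1 hbd) ▸ i).elim0

variable {r : ℝ → ℝ → ℕ} (h : IsRankFunction r)
include h

/-- The points of a persistence diagram with a given birth `b`, enumerated by decreasing death. -/
theorem exists_birth_enumeration : ∃ k : (rankDiagram r).Points → ℕ,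
    (∀ p q, p.1.1 = q.1.1 → k p = k q → p = q) ∧
    (∀ p, ∀ c : ℝ, p.1.1 < c → (c : WithTop ℝ) < p.1.2 → k p < bornAt r p.1.1 c) ∧
    (∀ p, ∀ c : ℝ, p.1.2 < (c : WithTop ℝ) → bornAt r p.1.1 c ≤ k p) ∧
    ∀ b c n, b < c → n < bornAt r b c → ∃ p, p.1.1 = b ∧ k p = n := by
  have H := fun b : ℝ => exists_enumeration (isUpperSet_Ioi b) (f := bornAt r b)
    (fun c hc c' _ hcc' => h.bornAt_anti hc hcc') (μ := fun d => rankDiagram r (b, d))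
    (fun d hd => rankDiagram_eq_zero (WithTop.coe_le_coe.2 (not_lt.1 hd)))
    (fun d hd => by
      filter_upwards [h.eventually_bornAt_jump hd, Ioo_mem_nhdsGT (sub_pos.2 hd)] with ε hε hε'
      exact ⟨Set.mem_Ioi.2 (by linarith [hε'.2]), hε⟩)
    ((h.exists_bornAt_eq_rankDiagram_top b).imp fun c₀ hc₀ c hc _ => hc₀ c hc)
  choose k hinj hlt hle hsurj using H
  refine ⟨fun p => k p.1.1 ⟨p.1.2, p.2⟩, ?_, fun p c hc hcd => hlt _ ⟨p.1.2, p.2⟩ c hc hcd,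
    fun p c hcd => hle _ ⟨p.1.2, p.2⟩ c hcd, fun b c n hbc hn => ?_⟩
  · rintro ⟨⟨b, d⟩, i⟩ ⟨⟨b', d'⟩, i'⟩ hb hk
    obtain rfl : b = b' := hb
    have e := hinj _ hk
    obtain rfl : d = d' := congrArg Sigma.fst e
    obtain rfl : i = i' := eq_of_heq (Sigma.mk.inj e).2
    rfl
  · obtain ⟨⟨d, i⟩, hp⟩ := hsurj b c hbc n hn
    exact ⟨⟨⟨b, d⟩, i⟩, rfl, hp⟩

/-- The points of a persistence diagram with a given death `d`, enumerated by increasing birth. -/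
theorem exists_death_enumeration : ∃ k : (rankDiagram r).Points → ℕ,
    (∀ p q, p.1.2 = q.1.2 → k p = k q → p = q) ∧
    (∀ p, ∀ a : ℝ, p.1.1 < a → (a : WithTop ℝ) < p.1.2 → k p < dyingAt r p.1.2 a) ∧
    (∀ p, ∀ a : ℝ, a < p.1.1 → dyingAt r p.1.2 a ≤ k p) ∧
    ∀ (d : WithTop ℝ) (a : ℝ) (n : ℕ), (a : WithTop ℝ) < d → n < dyingAt r d a → ∃ p, p.1.2 = d ∧ k p = n := by
  -- Births change sign so that a count increasing in the birth becomes antitone. The value at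
  -- infinity stands for birth at −∞, which does not occur by `eventually_zero`.
  let μ : WithTop ℝ → WithTop ℝ → ℕ := fun d x => match x with
    | some x => rankDiagram r (-x, d)
    | none => 0
  have H := fun d : WithTop ℝ => exists_enumeration (S := {x : ℝ | ((-x : ℝ) : WithTop ℝ) < d})
    (fun x y hxy hx => lt_of_le_of_lt (WithTop.coe_le_coe.2 (neg_le_neg hxy)) hx)
    (f := fun x => dyingAt r d (-x))
    (fun x hx y _ hxy => h.dyingAt_mono (neg_le_neg hxy) hx) (μ := μ d)
    (fun x hx => rankDiagram_eq_zero (not_lt.1 hx))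
    (fun x hx => by
      obtain ⟨y, hy, hyd⟩ := exists_between (show ((-x : ℝ) : WithTop ℝ) < d from hx)
      lift y to ℝ using hyd.ne_top
      filter_upwards [h.eventually_dyingAt_jump hx,
        Ioo_mem_nhdsGT (sub_pos.2 (WithTop.coe_lt_coe.1 hy))] with ε hε hε'
      refine ⟨lt_of_le_of_lt (WithTop.coe_le_coe.2 (by linarith [hε'.2])) hyd, ?_⟩
      change dyingAt r d (-(x - ε)) = dyingAt r d (-(x + ε)) + rankDiagram r (-x, d)
      rw [neg_add, ← sub_eq_add_neg, ← hε, neg_sub, sub_eq_neg_add])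
    (by
      obtain ⟨s, hs⟩ := h.eventually_zero
      refine ⟨-s + 1, fun c hc hcd => ?_⟩
      change dyingAt r d (-c) = 0
      have hc' : ∀ b, r (-c) b = 0 := hs (-c) (by linarith)
      induction d with
      | top =>
        obtain ⟨c', hc''⟩ := (h.eventually_dyingAt_top (-c)).exists
        rw [← hc'', hc']
      | coe d =>
        obtain ⟨ε, hε⟩ := (h.eventually_dyingAt (WithTop.coe_lt_coe.1 hcd)).exists
        rw [hc', hc'] at hε
        lia)
  choose k hinj hlt hle hsurj using H
  have hcast : ∀ b d, rankDiagram r (b, d) = μ d ((-b : ℝ) : WithTop ℝ) := fun b d => by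
    change _ = rankDiagram r (- -b, d)
    rw [neg_neg]
  let e (p : (rankDiagram r).Points) : Σ x, Fin (μ p.1.2 x) :=
    ⟨((-p.1.1 : ℝ) : WithTop ℝ), p.2.cast (hcast p.1.1 p.1.2)⟩
  refine ⟨fun p => k p.1.2 (e p), ?_, fun p a ha had => ?_, fun p a ha => ?_, fun d a n had hn => ?_⟩
  · rintro ⟨⟨b, d⟩, i⟩ ⟨⟨b', d'⟩, i'⟩ hd hk
    obtain rfl : d = d' := hd
    have he := hinj _ hk
    obtain rfl : b = b' := neg_injective (WithTop.coe_injective (congrArg Sigma.fst he))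
    obtain rfl : i = i' := Fin.cast_injective _ (eq_of_heq (Sigma.mk.inj he).2)
    rfl
  · have := hlt p.1.2 (e p) (-a) (by simpa using had) (WithTop.coe_lt_coe.2 (neg_lt_neg ha))
    rwa [neg_neg] at this
  · have := hle p.1.2 (e p) (-a) (WithTop.coe_lt_coe.2 (neg_lt_neg ha))
    rwa [neg_neg] at this
  · obtain ⟨⟨x, i⟩, hp⟩ := hsurj d (-a) (by simpa using had) n (by simpa using hn)
    induction x with
    | top => exact i.elim0
    | coe x =>
      obtain ⟨b, rfl⟩ := neg_surjective x
      exact ⟨⟨⟨b, d⟩, i.cast (hcast b d).symm⟩, rfl, hp⟩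

end IsRankFunction

/-! ### Stability of persistence diagrams -/

/-- The inequalities between the rank functions `rV` and `rW` of two `η`-interleaved persistence
modules and the rank function `rQ` of the image of `V` in the shift of `W` by `η`. -/
structure IsRankInterleaving (η : ℝ) (rV rQ rW : ℝ → ℝ → ℕ) : Prop where
  left : IsRankFunction rV
  mid : IsRankFunction rQ
  right : IsRankFunction rW
  surj : ∀ {a' a b}, a' ≤ a → a ≤ b → rQ a b + rV a' b ≤ rV a b + rQ a' b
  ker : ∀ {a' a b}, a' ≤ a → a ≤ b → rV a (b + 2 * η) + rQ a' b ≤ rQ a b + rV a' (b + 2 * η)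
  inj : ∀ {a b b'}, a ≤ b → b ≤ b' →
    rQ a b + rW (a + η) (b' + η) ≤ rW (a + η) (b + η) + rQ a b'
  coker : ∀ {a b b'}, a ≤ b → b ≤ b' →
    rW (a - η) (b + η) + rQ a b' ≤ rQ a b + rW (a - η) (b' + η)
  le : ∀ {a b}, a ≤ b → rQ a b ≤ rW (a + η) (b + η)
  ge : ∀ {a b}, a ≤ b → rW (a - η) (b + η) ≤ rQ a b

namespace IsRankInterleaving

variable {η : ℝ} {rV rQ rW : ℝ → ℝ → ℕ} (H : IsRankInterleaving η rV rQ rW)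
include H

/-- Surjectivity of V → Q: no new births occur in Q. -/
lemma bornAt_le {b c : ℝ} (hbc : b < c) : bornAt rQ b c ≤ bornAt rV b c := by
  obtain ⟨ε, h₁, h₂, h₃, h₄⟩ := ((H.left.eventually_bornAt hbc).and
    ((H.mid.eventually_bornAt hbc).and (Ioo_mem_nhdsGT (sub_pos.2 hbc)))).exists
  have := H.surj (show b - ε ≤ b + ε by linarith) (show b + ε ≤ c by linarith)
  lia

/-- The kernel of V → Q dies within 2η, so a class of V that lives 2η longer survives in Q. -/
lemma bornAt_ge (hη : 0 ≤ η) {b c : ℝ} (hbc : b < c) : bornAt rV b (c + 2 * η) ≤ bornAt rQ b c := by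
  obtain ⟨ε, h₁, h₂, h₃, h₄⟩ := ((H.left.eventually_bornAt (show b < c + 2 * η by linarith)).and
    ((H.mid.eventually_bornAt hbc).and (Ioo_mem_nhdsGT (sub_pos.2 hbc)))).exists
  have := H.ker (show b - ε ≤ b + ε by linarith) (show b + ε ≤ c by linarith)
  lia

/-- Injectivity of Q into the shift of W: deaths are preserved up to the shift. -/
lemma dyingAt_le {d : WithTop ℝ} {a : ℝ} (had : (a : WithTop ℝ) < d) :
    dyingAt rQ d a ≤ dyingAt rW (d + η) (a + η) := by
  induction d with
  | top =>
    obtain ⟨c, h₁, h₂, h₃⟩ := ((H.mid.eventually_dyingAt_top a).and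
      ((Filter.tendsto_atTop_add_const_right _ η Filter.tendsto_id |>.eventually
        (H.right.eventually_dyingAt_top (a + η))).and (Filter.eventually_ge_atTop a))).exists
    rw [WithTop.top_add, ← h₁, ← h₂]
    exact H.le h₃
  | coe d =>
    have had := WithTop.coe_lt_coe.1 had
    obtain ⟨ε, h₁, h₂, h₃, h₄⟩ := ((H.mid.eventually_dyingAt had).and
      ((H.right.eventually_dyingAt (show a + η < d + η by linarith)).and
        (Ioo_mem_nhdsGT (sub_pos.2 had)))).exists
    have := H.inj (show a ≤ d - ε by linarith) (show d - ε ≤ d + ε by linarith)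
    rw [← WithTop.coe_add]
    rw [show d + η - ε = d - ε + η by ring, show d + η + ε = d + ε + η by ring] at h₂
    lia

/-- The map W_{a−η} → W_{a+η} factors through V_a, so classes of W born by a − η lie in Q by a. -/
lemma dyingAt_ge (hη : 0 ≤ η) {d : WithTop ℝ} {a : ℝ} (had : (a : WithTop ℝ) < d) :
    dyingAt rW (d + η) (a - η) ≤ dyingAt rQ d a := by
  induction d with
  | top =>
    obtain ⟨c, h₁, h₂, h₃⟩ := ((H.mid.eventually_dyingAt_top a).and
      ((Filter.tendsto_atTop_add_const_right _ η Filter.tendsto_id |>.eventually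
        (H.right.eventually_dyingAt_top (a - η))).and (Filter.eventually_ge_atTop a))).exists
    rw [WithTop.top_add, ← h₁, ← h₂]
    exact H.ge h₃
  | coe d =>
    have had := WithTop.coe_lt_coe.1 had
    obtain ⟨ε, h₁, h₂, h₃, h₄⟩ := ((H.mid.eventually_dyingAt had).and
      ((H.right.eventually_dyingAt (show a - η < d + η by linarith)).and
        (Ioo_mem_nhdsGT (sub_pos.2 had)))).exists
    have := H.coker (show a ≤ d - ε by linarith) (show d - ε ≤ d + ε by linarith)
    rw [← WithTop.coe_add]
    rw [show d + η - ε = d - ε + η by ring, show d + η + ε = d + ε + η by ring] at h₂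
    lia

/-- The isometry theorem's stability half: interleaved persistence modules have diagrams at bounded
bottleneck distance. -/
theorem exists_isMatching (hη : 0 ≤ η) :
    ∃ M, PersistenceDiagram.IsMatching (rankDiagram rV) (rankDiagram rW) (ENNReal.ofReal η) M := by
  obtain ⟨kV, kV_inj, kV_lt, kV_le, kV_surj⟩ := H.left.exists_birth_enumeration
  obtain ⟨kQ, kQ_inj, kQ_lt, kQ_le, kQ_surj⟩ := H.mid.exists_birth_enumeration
  obtain ⟨jQ, jQ_inj, jQ_lt, jQ_le, jQ_surj⟩ := H.mid.exists_death_enumeration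
  obtain ⟨jW, jW_inj, jW_lt, jW_le, jW_surj⟩ := H.right.exists_death_enumeration
  have edist_le : ∀ {x y : ℝ}, x ≤ y + η → y ≤ x + η → edist x y ≤ ENNReal.ofReal η :=
    fun h₁ h₂ => by
      rw [edist_dist, Real.dist_eq]
      exact ENNReal.ofReal_le_ofReal (abs_le.2 ⟨by linarith, by linarith⟩)
  have diagonal_le : ∀ p : ℝ × WithTop ℝ, p.1 < p.2 → ¬ ((p.1 + 2 * η : ℝ) : WithTop ℝ) < p.2 →
      PersistenceDiagram.diagonalDist p ≤ ENNReal.ofReal η := by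
    rintro ⟨b, d⟩ h₁ h₂
    induction d with
    | top => exact absurd (WithTop.coe_lt_top _) h₂
    | coe d =>
      have h₁ := WithTop.coe_lt_coe.1 h₁
      have h₂ := not_lt.1 (mt WithTop.coe_lt_coe.2 h₂)
      change edist b d / 2 ≤ _
      refine ENNReal.div_le_of_le_mul ?_
      rw [edist_dist, Real.dist_eq, ← ENNReal.ofReal_ofNat 2, ← ENNReal.ofReal_mul hη]
      exact ENNReal.ofReal_le_ofReal (abs_le.2 ⟨by linarith, by linarith⟩)
  have hQW : ∀ q : (rankDiagram rQ).Points, ∃ q' : (rankDiagram rW).Points, q'.1.2 = q.1.2 + η ∧ jW q' = jQ q := fun q => by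
    obtain ⟨a, h₁, h₂⟩ := exists_between (IsRankFunction.birth_lt_death q)
    lift a to ℝ using h₂.ne_top
    have := (jQ_lt q a (WithTop.coe_lt_coe.1 h₁) h₂).trans_le (H.dyingAt_le h₂)
    refine jW_surj _ _ _ ?_ this
    rw [WithTop.coe_add]
    exact WithTop.add_lt_add_right WithTop.coe_ne_top h₂
  have hQV : ∀ q : (rankDiagram rQ).Points, ∃ p : (rankDiagram rV).Points, p.1.1 = q.1.1 ∧ kV p = kQ q := fun q => by
    obtain ⟨c, h₁, h₂⟩ := exists_between (IsRankFunction.birth_lt_death q)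
    lift c to ℝ using h₂.ne_top
    have h₁ := WithTop.coe_lt_coe.1 h₁
    exact kV_surj _ c _ h₁ ((kQ_lt q c h₁ h₂).trans_le (H.bornAt_le h₁))
  -- Each point q of Q has a partner in V with the same birth and position, and one in W with death
  -- shifted by η and the same position; the matching composes the two.
  refine ⟨fun p q' => ∃ q : (rankDiagram rQ).Points, (p.1.1 = q.1.1 ∧ kV p = kQ q) ∧ (q'.1.2 = q.1.2 + η ∧ jW q' = jQ q),
    ?_, ?_, ?_, ?_, ?_⟩
  · rintro p p' q' ⟨q₁, ⟨h₁, h₂⟩, h₃, h₄⟩ ⟨q₂, ⟨h₅, h₆⟩, h₇, h₈⟩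
    obtain rfl : q₁ = q₂ := jQ_inj _ _
      (WithTop.add_right_cancel WithTop.coe_ne_top (h₃.symm.trans h₇)) (h₄.symm.trans h₈)
    exact kV_inj _ _ (h₁.trans h₅.symm) (h₂.trans h₆.symm)
  · rintro p q₁' q₂' ⟨q₁, ⟨h₁, h₂⟩, h₃, h₄⟩ ⟨q₂, ⟨h₅, h₆⟩, h₇, h₈⟩
    obtain rfl : q₁ = q₂ := kQ_inj _ _ (h₁.symm.trans h₅) (h₂.symm.trans h₆)
    exact jW_inj _ _ (h₃.trans h₇.symm) (h₄.trans h₈.symm)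
  · rintro p q' ⟨q, ⟨hb, hk⟩, hd, hj⟩
    have hq := IsRankFunction.birth_lt_death q
    -- the deaths of `p` and `q`
    have h₁ : ¬ p.1.2 < q.1.2 := fun hlt => by
      obtain ⟨c, hc₁, hc₂⟩ := exists_between (max_lt hlt hq)
      lift c to ℝ using hc₂.ne_top
      obtain ⟨hc₁, hc₃⟩ := max_lt_iff.1 hc₁
      have hc₃ := WithTop.coe_lt_coe.1 hc₃
      have := kV_le p c hc₁
      have := kQ_lt q c hc₃ hc₂
      have := H.bornAt_le hc₃
      rw [hb] at *
      lia
    have h₂ : ∀ c : ℝ, q.1.2 < (c : WithTop ℝ) → ¬ ((c + 2 * η : ℝ) : WithTop ℝ) < p.1.2 :=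
      fun c hc hlt => by
        have hc' := WithTop.coe_lt_coe.1 (hq.trans hc)
        have := kQ_le q c hc
        have := kV_lt p (c + 2 * η) (by linarith) hlt
        have := H.bornAt_ge hη hc'
        rw [hb] at *
        lia
    -- the births of `q` and `q'`
    have h₃ : ¬ q.1.1 + η < q'.1.1 := fun hlt => by
      have hlt' : (q.1.1 : WithTop ℝ) < ((q'.1.1 - η : ℝ) : WithTop ℝ) :=
        WithTop.coe_lt_coe.2 (by linarith)
      obtain ⟨a, ha₁, ha₂⟩ := exists_between (lt_min hlt' hq)
      lift a to ℝ using ha₂.ne_top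
      obtain ⟨ha₂, ha₃⟩ := lt_min_iff.1 ha₂
      have ha₁ := WithTop.coe_lt_coe.1 ha₁
      have ha₂ := WithTop.coe_lt_coe.1 ha₂
      have := jQ_lt q a ha₁ ha₃
      have := jW_le q' (a + η) (by linarith)
      have := H.dyingAt_le ha₃
      rw [hd] at *
      lia
    have h₄ : ¬ q'.1.1 + η < q.1.1 := fun hlt => by
      obtain ⟨a, ha₁, ha₂⟩ := exists_between hlt
      have haq := (WithTop.coe_lt_coe.2 ha₂).trans hq
      have := jQ_le q a ha₂
      have := jW_lt q' (a - η) (by linarith) (by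
        rw [hd]
        refine lt_of_le_of_lt (WithTop.coe_le_coe.2 (show a - η ≤ a + η by linarith)) ?_
        rw [WithTop.coe_add]
        exact WithTop.add_lt_add_right WithTop.coe_ne_top haq)
      have := H.dyingAt_ge hη haq
      rw [hd] at *
      lia
    obtain ⟨⟨b, d⟩, i⟩ := p
    obtain ⟨⟨b', d'⟩, i'⟩ := q
    obtain ⟨⟨b'', d''⟩, i''⟩ := q'
    dsimp only at hb hd h₁ h₂ h₃ h₄ ⊢
    subst hb hd
    induction d' with
    | top =>
      obtain rfl := top_le_iff.1 (not_lt.1 h₁)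
      exact edist_le (by linarith) (by linarith)
    | coe d' =>
      induction d with
      | top => exact absurd (WithTop.coe_lt_top _) (h₂ (d' + 1) (WithTop.coe_lt_coe.2 (by linarith)))
      | coe d =>
        refine max_le (edist_le (by linarith) (by linarith)) (edist_le (x := d) (y := d' + η) ?_ ?_)
        · by_contra! hlt
          -- The midpoint of d' and d − 2η lies above d' and remains below d after adding 2η.
          refine h₂ ((d' + (d - 2 * η)) / 2) ?_ ?_ <;> refine WithTop.coe_lt_coe.2 ?_ <;> linarith
        · linarith [not_lt.1 (mt WithTop.coe_lt_coe.2 h₁)]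
  -- A point of V of persistence more than 2η has a partner in Q, and every point of Q has one in W.
  · refine fun p hp => diagonal_le _ (IsRankFunction.birth_lt_death p) fun hlt => ?_
    obtain ⟨x, h₁, h₂⟩ := exists_between hlt
    lift x to ℝ using h₂.ne_top
    have h₁ := WithTop.coe_lt_coe.1 h₁
    have hx : p.1.1 < x - 2 * η := by linarith
    have := kV_lt p x (by linarith) h₂
    have h' := H.bornAt_ge hη hx
    rw [sub_add_cancel] at h'
    obtain ⟨q, hq⟩ := kQ_surj _ _ _ hx (this.trans_le h')
    obtain ⟨q', hq'⟩ := hQW q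
    exact hp q' ⟨q, ⟨hq.1.symm, hq.2.symm⟩, hq'⟩
  · refine fun q' hq' => diagonal_le _ (IsRankFunction.birth_lt_death q') fun hlt => ?_
    obtain ⟨x, h₁, h₂⟩ := exists_between hlt
    lift x to ℝ using h₂.ne_top
    have h₁ := WithTop.coe_lt_coe.1 h₁
    obtain ⟨d, hd⟩ : ∃ d : WithTop ℝ, q'.1.2 = d + η := by
      cases hd : q'.1.2 with
      | top => exact ⟨⊤, rfl⟩
      | coe y => exact ⟨((y - η : ℝ) : WithTop ℝ), by rw [← WithTop.coe_add, sub_add_cancel]⟩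
    have hxd : ((x - η : ℝ) : WithTop ℝ) < d := by
      rw [hd, ← sub_add_cancel x η, WithTop.coe_add] at h₂
      exact lt_of_add_lt_add_right h₂
    have h₃ := jW_lt q' (x - η - η) (by linarith)
      (lt_of_le_of_lt (WithTop.coe_le_coe.2 (by linarith)) h₂)
    rw [hd] at h₃
    obtain ⟨q, hq⟩ := jQ_surj _ _ _ hxd (h₃.trans_le (H.dyingAt_ge hη hxd))
    obtain ⟨p, hp⟩ := hQV q
    exact hq' p ⟨q, hp, by rw [hd, hq.1], hq.2.symm⟩

theorem bottleneckDist_le (hη : 0 ≤ η) :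
    PersistenceDiagram.bottleneckDist (rankDiagram rV) (rankDiagram rW) ≤ ENNReal.ofReal η :=
  sInf_le (H.exists_isMatching hη)

end IsRankInterleaving

/-! ### Interleavings up to unique induced maps -/

section Interleaving

variable {𝕜 : Type w} [Field 𝕜]

/-- The rank inequality of Frobenius. -/
lemma LinearMap.finrank_range_comp_add_le {M' M N P : Type*} [AddCommGroup M'] [Module 𝕜 M']
    [AddCommGroup M] [Module 𝕜 M] [AddCommGroup N] [Module 𝕜 N] [AddCommGroup P] [Module 𝕜 P]
    [Module.Finite 𝕜 N] (f : M' →ₗ[𝕜] M) (g : M →ₗ[𝕜] N) (h : N →ₗ[𝕜] P) :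
    Module.finrank 𝕜 (range (h ∘ₗ g)) + Module.finrank 𝕜 (range (g ∘ₗ f)) ≤
      Module.finrank 𝕜 (range g) + Module.finrank 𝕜 (range (h ∘ₗ g ∘ₗ f)) := by
  -- The dimension lost by applying h to A is that of ker h ∩ A, which is monotone in A.
  have key : ∀ A : Submodule 𝕜 N, Module.finrank 𝕜 (A.map h) +
      Module.finrank 𝕜 (ker h ⊓ A : Submodule 𝕜 N) = Module.finrank 𝕜 A := fun A => by
    have := (h.domRestrict A).finrank_range_add_finrank_ker
    rw [LinearMap.range_domRestrict, LinearMap.ker_domRestrict] at this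
    rw [← this, ← Submodule.finrank_map_subtype_eq A, Submodule.map_comap_subtype, inf_comm]
  have h₁ := key (range g)
  have h₂ := key (range (g ∘ₗ f))
  have h₃ : Module.finrank 𝕜 (ker h ⊓ range (g ∘ₗ f) : Submodule 𝕜 N) ≤
      Module.finrank 𝕜 (ker h ⊓ range g : Submodule 𝕜 N) :=
    Submodule.finrank_mono (inf_le_inf_left _ (LinearMap.range_comp_le_range f g))
  rw [LinearMap.range_comp g h, LinearMap.range_comp (g ∘ₗ f) h]
  lia

variable {C : Type u} [Category.{v} C] (H : C ⥤ ModuleCat.{t} 𝕜)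

open Classical in
/-- The rank of the linear map induced by some morphism `x ⟶ y`, if there is one. -/
noncomputable def homRank (x y : C) : ℕ :=
  if h : Nonempty (x ⟶ y) then Module.finrank 𝕜 (LinearMap.range (H.map h.some).hom) else 0

variable {H} (hH : ∀ {x y : C} (f g : x ⟶ y), H.map f = H.map g)
include hH

/-- Frees rank computations from the structure maps: any morphism, and any factorisation of it, may
be used. -/
lemma homRank_eq {x y : C} (f : x ⟶ y) :
    homRank H x y = Module.finrank 𝕜 (LinearMap.range (H.map f).hom) := by
  rw [homRank, dif_pos ⟨f⟩, hH _ f]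

lemma homRank_le_right {x y z : C} [Module.Finite 𝕜 (H.obj z)] (f : x ⟶ y) (g : y ⟶ z) :
    homRank H x z ≤ homRank H y z := by
  rw [homRank_eq hH (f ≫ g), homRank_eq hH g, H.map_comp, ModuleCat.hom_comp]
  exact Submodule.finrank_mono (LinearMap.range_comp_le_range _ _)

lemma homRank_le_left {x y z : C} [Module.Finite 𝕜 (H.obj y)] (f : x ⟶ y) (g : y ⟶ z) :
    homRank H x z ≤ homRank H x y := by
  rw [homRank_eq hH (f ≫ g), homRank_eq hH f, H.map_comp, ModuleCat.hom_comp, LinearMap.range_comp]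
  exact Submodule.finrank_map_le _ _

lemma homRank_add_le {x' x y z : C} [Module.Finite 𝕜 (H.obj y)] (f : x' ⟶ x) (g : x ⟶ y)
    (h : y ⟶ z) : homRank H x z + homRank H x' y ≤ homRank H x y + homRank H x' z := by
  rw [homRank_eq hH (g ≫ h), homRank_eq hH (f ≫ g), homRank_eq hH g, homRank_eq hH ((f ≫ g) ≫ h)]
  rw [H.map_comp, H.map_comp, H.map_comp, H.map_comp]
  exact LinearMap.finrank_range_comp_add_le _ _ _

omit hH in
lemma Tower.persistenceDiagram_eq_rankDiagram (V : Tower (ModuleCat.{t} 𝕜)) :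
    V.persistenceDiagram = rankDiagram V.rank := by
  funext ⟨b, d⟩
  cases d <;> rfl

omit hH in
lemma Tower.rank_of_lt (V : Tower (ModuleCat.{t} 𝕜)) {a : ℝ} (ha : a < V.res) (b : ℝ) :
    V.rank a b = 0 := dif_neg fun h => ha.not_ge h.1

lemma Tower.rank_map_eq (S : Tower C) {a b : ℝ} (ha : S.res ≤ a) (hab : a ≤ b) :
    (S.map H).rank a b =
      homRank H (S.functor.obj ⟨a, ha⟩) (S.functor.obj ⟨b, ha.trans hab⟩) := by
  rw [homRank_eq hH (S.functor.map (homOfLE hab))]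
  exact dif_pos ⟨ha, hab⟩

lemma Tower.isRankFunction_map (S : Tower C)
    (hS : ∀ a, Module.Finite 𝕜 (H.obj (S.functor.obj a))) : IsRankFunction (S.map H).rank where
  mono {a' a b} h₁ h₂ := by
    by_cases ha' : S.res ≤ a'
    · rw [Tower.rank_map_eq hH S ha' (h₁.trans h₂), Tower.rank_map_eq hH S (ha'.trans h₁) h₂]
      exact homRank_le_right hH (S.functor.map (homOfLE h₁)) (S.functor.map (homOfLE h₂))
    · rw [Tower.rank_of_lt (S.map H) (not_le.1 ha')]
      exact zero_le
  anti {a b b'} h₁ h₂ := by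
    by_cases ha : S.res ≤ a
    · rw [Tower.rank_map_eq hH S ha (h₁.trans h₂), Tower.rank_map_eq hH S ha h₁]
      exact homRank_le_left hH (S.functor.map (homOfLE h₁)) (S.functor.map (homOfLE h₂))
    · rw [Tower.rank_of_lt (S.map H) (not_le.1 ha)]
      exact zero_le
  rect {a' a b b'} h₁ h₂ h₃ := by
    by_cases ha' : S.res ≤ a'
    · rw [Tower.rank_map_eq hH S ha' (h₁.trans h₂), Tower.rank_map_eq hH S (ha'.trans h₁) h₂,
        Tower.rank_map_eq hH S (ha'.trans h₁) (h₂.trans h₃),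
        Tower.rank_map_eq hH S ha' (h₁.trans (h₂.trans h₃)), add_comm]
      exact homRank_add_le hH (S.functor.map (homOfLE h₁)) (S.functor.map (homOfLE h₂))
        (S.functor.map (homOfLE h₃))
    · rw [Tower.rank_of_lt (S.map H) (not_le.1 ha'), Tower.rank_of_lt (S.map H) (not_le.1 ha')]
      by_cases ha : S.res ≤ a
      · rw [Tower.rank_map_eq hH S ha (h₂.trans h₃), Tower.rank_map_eq hH S ha h₂, zero_add,
          add_zero]
        exact homRank_le_left hH (S.functor.map (homOfLE h₂)) (S.functor.map (homOfLE h₃))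
      · rw [Tower.rank_of_lt (S.map H) (not_le.1 ha), Tower.rank_of_lt (S.map H) (not_le.1 ha)]
  eventually_zero := ⟨S.res, fun _ ha b => Tower.rank_of_lt (S.map H) ha b⟩

end Interleaving

/-- Two towers in `C` that are interleaved by any morphisms have diagrams at bounded bottleneck
distance, after applying a functor that does not distinguish parallel morphisms. -/
theorem Tower.bottleneckDist_map_le {𝕜 : Type w} [Field 𝕜] {C : Type u} [Category.{v} C]
    {H : C ⥤ ModuleCat.{t} 𝕜} (hH : ∀ {x y : C} (f g : x ⟶ y), H.map f = H.map g)
    {S T : Tower C} (hres : S.res = T.res) [hS : ∀ a, Module.Finite 𝕜 (H.obj (S.functor.obj a))]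
    [hT : ∀ a, Module.Finite 𝕜 (H.obj (T.functor.obj a))] {η : ℝ} (hη : 0 ≤ η)
    (hST : ∀ a b, a.1 + η ≤ b.1 → Nonempty (S.functor.obj a ⟶ T.functor.obj b))
    (hTS : ∀ a b, a.1 + η ≤ b.1 → Nonempty (T.functor.obj a ⟶ S.functor.obj b)) :
    PersistenceDiagram.bottleneckDist (S.map H).persistenceDiagram (T.map H).persistenceDiagram
      ≤ ENNReal.ofReal η := by
  classical
  rw [Tower.persistenceDiagram_eq_rankDiagram, Tower.persistenceDiagram_eq_rankDiagram]
  have hl := Tower.isRankFunction_map hH S hS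
  have hr := Tower.isRankFunction_map hH T hT
  have hst {a b} (ha : S.res ≤ a) (hb : T.res ≤ b) (h : a + η ≤ b) :
      S.functor.obj ⟨a, ha⟩ ⟶ T.functor.obj ⟨b, hb⟩ := (hST ⟨a, ha⟩ ⟨b, hb⟩ h).some
  have hts {a b} (ha : T.res ≤ a) (hb : S.res ≤ b) (h : a + η ≤ b) :
      T.functor.obj ⟨a, ha⟩ ⟶ S.functor.obj ⟨b, hb⟩ := (hTS ⟨a, ha⟩ ⟨b, hb⟩ h).some
  have hs {a b} (ha : S.res ≤ a) (hb : S.res ≤ b) (h : a ≤ b) :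
      S.functor.obj ⟨a, ha⟩ ⟶ S.functor.obj ⟨b, hb⟩ := S.functor.map (homOfLE h)
  have ht {a b} (ha : T.res ≤ a) (hb : T.res ≤ b) (h : a ≤ b) :
      T.functor.obj ⟨a, ha⟩ ⟶ T.functor.obj ⟨b, hb⟩ := T.functor.map (homOfLE h)
  have hshift {a b} (ha : S.res ≤ a) (h : a ≤ b) : T.res ≤ b + η := by linarith
  -- The image of Q_a in Q_b is the image of V_a in W_{b+η}.
  let rQ : ℝ → ℝ → ℕ := fun a b => if h : S.res ≤ a ∧ a ≤ b then
    homRank H (S.functor.obj ⟨a, h.1⟩) (T.functor.obj ⟨b + η, hshift h.1 h.2⟩) else 0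
  have hQ {a b} (ha : S.res ≤ a) (hab : a ≤ b) :
      rQ a b = homRank H (S.functor.obj ⟨a, ha⟩) (T.functor.obj ⟨b + η, hshift ha hab⟩) :=
    dif_pos ⟨ha, hab⟩
  have hQ₀ {a} (ha : ¬ S.res ≤ a) (b) : rQ a b = 0 := dif_neg fun h => ha h.1
  have hV₀ {a} (ha : ¬ S.res ≤ a) (b) : (S.map H).rank a b = 0 :=
    Tower.rank_of_lt (S.map H) (not_le.1 ha) b
  have hV {a b} (ha : S.res ≤ a) (hab : a ≤ b) := Tower.rank_map_eq hH S ha hab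
  have hW {a b} (ha : T.res ≤ a) (hab : a ≤ b) := Tower.rank_map_eq hH T ha hab
  have anti {a b b'} (h₁ : a ≤ b) (h₂ : b ≤ b') : rQ a b' ≤ rQ a b := by
    by_cases ha : S.res ≤ a
    · rw [hQ ha h₁, hQ ha (h₁.trans h₂)]
      exact homRank_le_left hH (hst _ _ (by linarith)) (ht _ _ (by linarith))
    · rw [hQ₀ ha]
      exact zero_le
  refine IsRankInterleaving.bottleneckDist_le (η := η) (rQ := rQ) ⟨hl, ⟨?_, anti, ?_, ?_⟩, hr,
    ?_, ?_, ?_, ?_, ?_, ?_⟩ hη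
  · intro a' a b h₁ h₂
    by_cases ha' : S.res ≤ a'
    · rw [hQ ha' (h₁.trans h₂), hQ (ha'.trans h₁) h₂]
      exact homRank_le_right hH (hs _ _ h₁) (hst _ _ (by linarith))
    · rw [hQ₀ ha']
      exact zero_le
  · intro a' a b b' h₁ h₂ h₃
    by_cases ha' : S.res ≤ a'
    · have ha := ha'.trans h₁
      rw [hQ ha' (h₁.trans h₂), hQ ha (h₂.trans h₃), hQ ha h₂, hQ ha' (h₁.trans (h₂.trans h₃)),
        add_comm]
      exact homRank_add_le hH (hs _ _ h₁) (hst _ _ (by linarith)) (ht _ _ (by linarith))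
    · rw [hQ₀ ha', hQ₀ ha', zero_add, add_zero]
      exact anti h₂ h₃
  · exact ⟨S.res, fun a ha b => hQ₀ (not_le.2 ha) b⟩
  -- Frobenius for V_{a'} → V_a → V_b → W_{b+η}. Below the resolution, here and in the next three
  -- cases, the inequality reduces to monotonicity of rank or to equality.
  · intro a' a b h₁ h₂
    by_cases ha : S.res ≤ a
    · by_cases ha' : S.res ≤ a'
      · rw [hQ ha h₂, hV ha' (h₁.trans h₂), hV ha h₂, hQ ha' (h₁.trans h₂)]
        exact homRank_add_le hH (hs _ _ h₁) (hs _ _ h₂) (hst _ _ le_rfl)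
      · rw [hV₀ ha', hQ₀ ha', hQ ha h₂, hV ha h₂]
        exact homRank_le_left hH (hs _ _ h₂) (hst _ _ le_rfl)
    · have ha' : ¬ S.res ≤ a' := fun h => ha (h.trans h₁)
      rw [hV₀ ha', hQ₀ ha', hQ₀ ha, hV₀ ha]
  -- Frobenius for V_{a'} → V_a → W_{b+η} → V_{b+2η}.
  · intro a' a b h₁ h₂
    by_cases ha : S.res ≤ a
    · have hb : a ≤ b + 2 * η := by linarith
      by_cases ha' : S.res ≤ a'
      · rw [hQ ha h₂, hV ha' (h₁.trans hb), hV ha hb, hQ ha' (h₁.trans h₂)]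
        exact homRank_add_le hH (hs _ _ h₁) (hst _ _ (by linarith)) (hts _ _ (by linarith))
      · rw [hV₀ ha', hQ₀ ha', hQ ha h₂, hV ha hb]
        exact homRank_le_left hH (hst _ _ (by linarith)) (hts _ _ (by linarith))
    · have ha' : ¬ S.res ≤ a' := fun h => ha (h.trans h₁)
      rw [hV₀ ha', hQ₀ ha', hQ₀ ha, hV₀ ha]
  -- Frobenius for V_a → W_{a+η} → W_{b+η} → W_{b'+η}.
  · intro a b b' h₁ h₂
    by_cases ha : S.res ≤ a
    · have ha' := hshift ha le_rfl
      rw [hQ ha h₁, hQ ha (h₁.trans h₂), hW ha' (by linarith), hW ha' (by linarith), add_comm]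
      exact homRank_add_le hH (hst _ _ le_rfl) (ht _ _ (by linarith)) (ht _ _ (by linarith))
    · rw [hQ₀ ha, hQ₀ ha, zero_add, add_zero]
      exact hr.anti (by linarith) (by linarith)
  -- Frobenius for W_{a−η} → V_a → W_{b+η} → W_{b'+η}.
  · intro a b b' h₁ h₂
    by_cases ha : T.res ≤ a - η
    · have ha' : S.res ≤ a := by linarith
      rw [hQ ha' h₁, hQ ha' (h₁.trans h₂), hW ha (by linarith), hW ha (by linarith), add_comm]
      exact homRank_add_le hH (hts _ _ (by linarith)) (hst _ _ (by linarith))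
        (ht _ _ (by linarith))
    · rw [Tower.rank_of_lt (T.map H) (not_le.1 ha), Tower.rank_of_lt (T.map H) (not_le.1 ha),
        zero_add, add_zero]
      exact anti h₁ h₂
  · intro a b h
    by_cases ha : S.res ≤ a
    · rw [hQ ha h, hW (hshift ha le_rfl) (by linarith)]
      exact homRank_le_right hH (hst _ _ le_rfl) (ht _ _ (by linarith))
    · rw [hQ₀ ha]
      exact zero_le
  · intro a b h
    by_cases ha : T.res ≤ a - η
    · rw [hW ha (by linarith), hQ (show S.res ≤ a by linarith) h]
      exact homRank_le_right hH (hts _ _ (by linarith)) (hst _ _ (by linarith))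
    · rw [Tower.rank_of_lt (T.map H) (not_le.1 ha)]
      exact zero_le

/-! ### Simplicial homology of nerves -/

open Classical in
open MonoidalCategory Simplicial in
/-- Contiguous simplicial maps induce homotopic maps of simplicial sets. -/
noncomputable def SimplicialComplex.contiguousHomotopy {K L : SimplicialComplex.{v}} (φ ψ : K ⟶ L)
    (h : ∀ σ ∈ K.complex, σ.image φ.toFun ∪ σ.image ψ.toFun ∈ L.complex) :
    SSet.Homotopy (SimplicialComplex.toSSet.map φ) (SimplicialComplex.toSSet.map ψ) where
  h :=
    { app := fun n => ↾fun x => ⟨fun i =>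
        -- The prism map: vertices over the end 0 of the interval move by φ, those over 1 by ψ.
        -- Contiguity makes the mixed simplex a face.
        if (SSet.stdSimplex.objEquiv x.2).toOrderHom i = 0 then φ.toFun (x.1.1 i) else ψ.toFun (x.1.1 i), by
          refine (L.complex.isRelLowerSet_faces (h _ x.1.2)).2 ?_ (Finset.univ_nonempty.image _)
          intro y hy
          obtain ⟨i, -, rfl⟩ := Finset.mem_image.1 hy
          dsimp only
          split_ifs
          · exact Finset.mem_union_left _
              (Finset.mem_image_of_mem _ (Finset.mem_image_of_mem _ (Finset.mem_univ _)))
          · exact Finset.mem_union_right _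
              (Finset.mem_image_of_mem _ (Finset.mem_image_of_mem _ (Finset.mem_univ _)))⟩
      naturality := fun m n θ => rfl }
  h₀ := by
    ext n x
    rfl
  h₁ := by
    ext n x
    rfl
  rel := by ext _ ⟨⟨_, ⟨⟩⟩, _⟩

/-- Parallel maps of covers induce the same map in the homology of the nerves. -/
theorem Cover.nerve_homology_map_eq {X : Type u} {U V : Cover.{u, v} X} (ξ ζ : U ⟶ V)
    (𝕜 : Type w) [Field 𝕜] (k : ℕ) :
    (Cover.nerve ⋙ SimplicialComplex.homology 𝕜 k).map ξ =
      (Cover.nerve ⋙ SimplicialComplex.homology 𝕜 k).map ζ := by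
  classical
  refine SSet.Homotopy.congr_homologyMap (SimplicialComplex.contiguousHomotopy
    (Cover.nerve.map ξ) (Cover.nerve.map ζ) ?_) _ k
  -- A point common to the members indexed by σ lies in their targets under both maps, so the union
  -- of the two images is a face.
  rintro σ ⟨hσ, x, hx⟩
  refine ⟨(hσ.image _).mono Finset.subset_union_left, x, ?_⟩
  rw [Set.mem_iInter₂] at hx ⊢
  intro j hj
  obtain hj | hj := Finset.mem_union.1 hj <;> obtain ⟨i, hi, rfl⟩ := Finset.mem_image.1 hj
  · exact ξ.subset i (hx i hi)
  · exact ζ.subset i (hx i hi)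

open Limits in
/-- A finite coproduct of finite modules is finite. -/
lemma ModuleCat.finite_of_isColimit_cofan {R : Type u} [Ring R] {ι : Type w} [Finite ι]
    {M : ι → ModuleCat.{v} R} [∀ i, Module.Finite R (M i)] (c : Cofan M) (hc : IsColimit c) :
    Module.Finite R c.pt := by
  have h : (⨆ i, LinearMap.range (c.inj i).hom) = ⊤ := by
    set N := ⨆ i, LinearMap.range (c.inj i).hom
    rw [← N.ker_mkQ, LinearMap.ker_eq_top]
    -- The quotient by the sum of the ranges receives the zero map from every summand, so the ranges
    -- span.
    have : ModuleCat.ofHom N.mkQ = 0 := hc.hom_ext fun ⟨i⟩ => by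
      ext x
      exact (Submodule.Quotient.mk_eq_zero N).2
        (Submodule.mem_iSup_of_mem i (LinearMap.mem_range_self (c.inj i).hom x))
    exact congrArg ModuleCat.Hom.hom this
  refine ⟨h ▸ Submodule.fg_iSup _ fun i => ?_⟩
  rw [LinearMap.range_eq_map]
  exact Module.Finite.fg_top.map _

/-- The n-chains are a finite coproduct of copies of M; cycles form a subspace of them and homology
a quotient of the cycles. -/
theorem SSet.finite_homology {𝕜 : Type w} [Field 𝕜] (X : SSet.{v}) [∀ n, Finite (X.obj n)]
    (M : ModuleCat.{max v w} 𝕜) [Module.Finite 𝕜 M] (n : ℕ) :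
    Module.Finite 𝕜 (SSet.homology (C := ModuleCat.{max v w} 𝕜) X M n) := by
  have : Module.Finite 𝕜 ((X.chainComplex M).X n) :=
    ModuleCat.finite_of_isColimit_cofan _ (X.isColimitChainComplexXCofan M n)
  have : Module.Finite 𝕜 ((X.chainComplex M).cycles n) :=
    Module.Finite.of_injective ((X.chainComplex M).iCycles n).hom
      ((ModuleCat.mono_iff_injective _).1 inferInstance)
  exact Module.Finite.of_surjective ((X.chainComplex M).homologyπ n).hom
      ((ModuleCat.epi_iff_surjective _).1 inferInstance)

theorem Cover.finite_nerve_homology {X : Type u} (U : Cover.{u, v} X) [Finite U.ι]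
    (𝕜 : Type w) [Field 𝕜] (k : ℕ) :
    Module.Finite 𝕜 ((Cover.nerve ⋙ SimplicialComplex.homology 𝕜 k).obj U) := by
  have : ∀ n, Finite ((SimplicialComplex.toSSet.obj (Cover.nerve.obj U)).obj n) := fun n => by
    have : Finite (Cover.nerve.obj U).V := ‹Finite U.ι›
    exact Subtype.finite
  exact SSet.finite_homology _ _ _

/-! ### The interleaving of multiscale mappers -/

/-- In a connected compact metric space, the `m`-neighbourhood of a nonempty set has diameter at
least `s` if `s ≤ m` and `s` is at most the diameter of the space. -/
lemma Metric.le_diam_neighborhood {Z : Type v} [MetricSpace Z] [CompactSpace Z] [ConnectedSpace Z]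
    {s m : ℝ} (hs : 0 ≤ s) (hsm : s ≤ m) (hZ : s ≤ Metric.diam (Set.univ : Set Z)) {U : Set Z}
    (hU : U.Nonempty) : s ≤ Metric.diam {z | ∃ u ∈ U, dist z u ≤ m} := by
  obtain ⟨x, hx⟩ := hU
  by_cases h : ∃ y, s ≤ dist y x
  · obtain ⟨y, hy⟩ := h
    obtain ⟨z, hz⟩ : s ∈ Set.range fun z => dist z x :=
      -- By connectedness some z is at distance exactly s from x; it lies in the neighbourhood
      -- because s ≤ m.
      (isPreconnected_range (continuous_id.dist continuous_const)).Icc_subset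
        ⟨x, dist_self x⟩ ⟨y, rfl⟩ ⟨hs, hy⟩
    rw [← hz]
    exact Metric.dist_le_diam_of_mem (Bornology.IsBounded.all _)
      ⟨x, hx, hz.le.trans hsm⟩ ⟨x, hx, by rw [dist_self]; exact hs.trans hsm⟩
  · push Not at h
    convert hZ
    exact Set.eq_univ_of_forall fun z => ⟨x, hx, (h z).le.trans hsm⟩

namespace IsGoodTower

variable {X : Type u} [TopologicalSpace X] {Z : Type v} [MetricSpace Z] [CompactSpace Z]
  [ConnectedSpace Z] {c s : ℝ} {W : Tower (Cover.{v, w} Z)} (hW : IsGoodTower c s W)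
include hW

/-- If `f` and `g` are at distance at most `m`, then there is a map of covers from the pullback
along `f` of the cover at `a` to the pullback along `g` of the cover at `c * (a + 2 * m)`. -/
theorem nonempty_pullback_hom {f g : X → Z} {m : ℝ} (hsm : s ≤ m)
    (hfg : ∀ x, dist (f x) (g x) ≤ m) (a b : Set.Ici W.res) (hab : c * (a.1 + 2 * m) ≤ b.1) :
    Nonempty ((Cover.pullback f).obj (W.functor.obj a) ⟶
      (Cover.pullback g).obj (W.functor.obj b)) := by
  have hs := hW.pos
  have key : ∀ i, ∃ j, f ⁻¹' (W.functor.obj a).set i ⊆ g ⁻¹' (W.functor.obj b).set j := fun i => by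
    set U := (W.functor.obj a).set i with hU
    set O := {z | ∃ u ∈ U, dist z u ≤ m}
    have hsO : s ≤ Metric.diam O := Metric.le_diam_neighborhood hs.le hsm hW.le_diam
      ((hW.isFinitePathConnectedOpen a).isPathConnected i).nonempty
    have ha : s ≤ a.1 := hW.res_eq ▸ a.2
    have hOa : Metric.diam O ≤ a.1 + 2 * m := by
      refine Metric.diam_le_of_forall_dist_le (by linarith) ?_
      rintro z ⟨u, hu, hzu⟩ z' ⟨u', hu', hzu'⟩
      have := (Metric.dist_le_diam_of_mem (Bornology.IsBounded.all U) hu hu').trans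
        (hW.diam_le a i)
      linarith [dist_triangle4 z u u' z', dist_comm z' u']
    obtain ⟨hres, j, hj⟩ := hW.exists_superset O hsO
    have hle : c * Metric.diam O ≤ b.1 :=
      (mul_le_mul_of_nonneg_left hOa (zero_le_one.trans hW.one_le)).trans hab
    let w := W.functor.map (homOfLE (show (⟨_, hres⟩ : Set.Ici W.res) ≤ b from hle))
    -- If f x ∈ U, then g x is within m of f x, hence in O.
    exact ⟨w.toFun j, fun x hx => w.subset j (hj ⟨f x, hx, by rw [dist_comm]; exact hfg x⟩)⟩
  choose ξ hξ using key
  exact ⟨{ toFun := fun p => ⟨ξ p.1, Cover.componentMap (hξ p.1) p.2⟩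
           subset := fun _ => Cover.componentSet_subset _ _ }⟩

/-- The additive term 2cm is absorbed into a multiplicative one: exp a ≥ s gives exp a · max(1, 1/s)
≥ 1. This is the source of the summand max(0, log(1/s)). -/
theorem nonempty_logReindex_pullback_hom {f g : X → Z} {m : ℝ} (hsm : s ≤ m)
    (hfg : ∀ x, dist (f x) (g x) ≤ m) (a b : Set.Ici (Real.log W.res))
    (hab : a.1 + (Real.log (2 * c * m + c) + max 0 (Real.log (1 / s))) ≤ b.1) :
    Nonempty ((W.logReindex.map (Cover.pullback f)).functor.obj a ⟶
      (W.logReindex.map (Cover.pullback g)).functor.obj b) := by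
  refine hW.nonempty_pullback_hom hsm hfg _ _ ((?_ : _ ≤ _).trans (Real.exp_le_exp.2 hab))
  have hs := hW.pos
  have hc := zero_lt_one.trans_le hW.one_le
  have hm := hs.trans_le hsm
  set K := Real.exp (max 0 (Real.log (1 / s)))
  have hK₁ : 1 ≤ K := Real.one_le_exp (le_max_left _ _)
  have hK₂ : 1 / s ≤ K := (Real.exp_log (one_div_pos.2 hs)).symm.trans_le
    (Real.exp_le_exp.2 (le_max_right _ _))
  have ha : s ≤ Real.exp a.1 := by
    rw [← Real.exp_log hs]
    exact Real.exp_le_exp.2 (hW.res_eq ▸ a.2)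
  rw [Real.exp_add, Real.exp_add, Real.exp_log (by positivity)]
  change c * (Real.exp a.1 + 2 * m) ≤ Real.exp a.1 * ((2 * c * m + c) * K)
  have h₁ : Real.exp a.1 ≤ Real.exp a.1 * K := le_mul_of_one_le_right (Real.exp_pos _).le hK₁
  have h₂ : 1 ≤ Real.exp a.1 * K := by
    calc (1 : ℝ) = s * (1 / s) := by field_simp
      _ ≤ _ := mul_le_mul ha hK₂ (by positivity) (by positivity)
  calc c * (Real.exp a.1 + 2 * m) = c * Real.exp a.1 + 2 * c * m * 1 := by ring
    _ ≤ c * (Real.exp a.1 * K) + 2 * c * m * (Real.exp a.1 * K) := by gcongr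
    _ = _ := by ring

omit [CompactSpace Z] [ConnectedSpace Z] in
theorem finite_pullback_homology {f : X → Z} (hf : IsWellBehaved f) (𝕜 : Type t) [Field 𝕜] (k : ℕ)
    (a : Set.Ici (Real.log W.res)) :
    Module.Finite 𝕜 ((Cover.nerve ⋙ SimplicialComplex.homology 𝕜 k).obj
      ((W.logReindex.map (Cover.pullback f)).functor.obj a)) := by
  have : Finite ((W.logReindex.map (Cover.pullback f)).functor.obj a).ι := by
    have hU := hW.isFinitePathConnectedOpen
      ⟨Real.exp a, (Real.le_exp_log W.res).trans (Real.exp_le_exp.2 a.2)⟩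
    have : Finite (W.logReindex.functor.obj a).ι := hU.finite
    have : ∀ i, Finite (ZerothHomotopy (f ⁻¹' (W.logReindex.functor.obj a).set i)) := fun i => hf _ (hU.isOpen i) (hU.isPathConnected i)
    exact Finite.instSigma
  exact Cover.finite_nerve_homology _ 𝕜 k

end IsGoodTower

theorem mainTheorem7 {X : Type u} [TopologicalSpace X]
    {Z : Type v} [MetricSpace Z] [CompactSpace Z] [ConnectedSpace Z]
    (c s δ : ℝ) (W : Tower (Cover.{v, w} Z)) (hW : IsGoodTower c s W)
    (f g : X → Z) (hf : Continuous f) (hg : Continuous g)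
    (hf' : IsWellBehaved f) (hg' : IsWellBehaved g)
    (hδ : IsLUB (Set.range fun x => dist (f x) (g x)) δ)
    (𝕜 : Type t) [Field 𝕜] (k : ℕ) :
    PersistenceDiagram.bottleneckDist
        ((multiscaleMapper W.logReindex f).diagram 𝕜 k)
        ((multiscaleMapper W.logReindex g).diagram 𝕜 k)
      ≤ ENNReal.ofReal (Real.log (2 * c * max s δ + c) + max 0 (Real.log (1 / s))) := by

  have hm : ∀ x, dist (f x) (g x) ≤ max s δ :=
    fun x => (hδ.1 (Set.mem_range_self x)).trans (le_max_right s δ)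
  have hη : 0 ≤ Real.log (2 * c * max s δ + c) + max 0 (Real.log (1 / s)) := by
    have hc := hW.one_le
    have hs := hW.pos.trans_le (le_max_left s δ)
    -- The argument of the logarithm is at least c ≥ 1.
    exact add_nonneg (Real.log_nonneg (by nlinarith)) (le_max_left _ _)
  exact Tower.bottleneckDist_map_le (H := Cover.nerve ⋙ SimplicialComplex.homology 𝕜 k)
    (fun ξ ζ => Cover.nerve_homology_map_eq ξ ζ 𝕜 k)
    (S := W.logReindex.map (Cover.pullback f)) (T := W.logReindex.map (Cover.pullback g)) rfl
    (hS := hW.finite_pullback_homology hf' 𝕜 k) (hT := hW.finite_pullback_homology hg' 𝕜 k) hη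
    (hW.nonempty_logReindex_pullback_hom (le_max_left s δ) hm)
    (hW.nonempty_logReindex_pullback_hom (le_max_left s δ) fun x => by
      rw [dist_comm]; exact hm x)
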